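/- Let $T$ be a one-sorted strongly minimal (complete) theory with elimination of imaginaries, let $M$ be a saturated model of $T$, let $\bar e$ be a finite tuple from $M$ with $\bar e\notin\operatorname{acl}(\emptyset)$, and let $p(\bar x)$ be a stationary complete type over $\bar e$, in a finite tuple of variables $\bar x$, whose canonical base is $\bar e$ (that is, $p$ has exactly one nonforking extension $q$ to a complete type over $M$, and an automorphism of $M$ fixes $q$ if and only if it fixes $\bar e$). Then there are a formula over $\bar e$ belonging to $p$, defining a set $X$, and a finite tuple $\bar c\in\operatorname{dcl}(\bar e)$ such that 1. $\bar e$ is a canonical parameter of $X$: an automorphism of $M$ maps $X$ onto itself if and only if it fixes $\bar e$; 2. $\bar e\notin\operatorname{acl}(\bar c)$; 3. $X$ is weakly normal relative to $\bar c$: $X$ is nonempty, and every $\bar a\in X$ belongs to only finitely many conjugates of $X$ under the automorphisms of $M$ that fix $\bar c$. Here, for a tuple $\bar e$ and a set $A$, $\bar e\notin\operatorname{acl}(A)$ means that some coordinate of $\bar e$ is not in $\operatorname{acl}(A)$. -/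

import Mathlib

open FirstOrder FirstOrder.Language Cardinal

universe u v w

namespace ModelTh

/-! ### Strong minimality and elimination of imaginaries -/

/-- `T` is strongly minimal: it is complete, its models are infinite, and in every model every
subset of the home sort that is definable with parameters is finite or cofinite. -/
def StronglyMinimal {L : FirstOrder.Language.{u, v}} (T : L.Theory) : Prop :=
  T.IsComplete ∧
    ∀ N : Theory.ModelType.{u, v, max u v w} T,
      Infinite N ∧ ∀ S : Set N, (Set.univ : Set N).Definable₁ L S → S.Finite ∨ Sᶜ.Finite

/-- `T` eliminates imaginaries: in every model `N`, for every `∅`-definable equivalence relation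
`E` on `N ^ n` and every `a`, the imaginary `a / E` is interdefinable with a finite tuple `b` of
elements of `N`: for some formula `ψ (x, y)` without parameters, `b` is the unique tuple such that
`ψ (x, b)` defines the class of `a`. -/
def EliminatesImaginaries {L : FirstOrder.Language.{u, v}} (T : L.Theory) : Prop :=
  ∀ (N : Theory.ModelType.{u, v, max u v w} T) (n : ℕ) (E : Setoid (Fin n → N)),
    (∃ φ : L.Formula (Fin n ⊕ Fin n), ∀ a a', E a a' ↔ φ.Realize (Sum.elim a a')) →
    ∀ a : Fin n → N, ∃ (m : ℕ) (b : Fin m → N) (ψ : L.Formula (Fin n ⊕ Fin m)),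
      ∀ b' : Fin m → N, (∀ x, ψ.Realize (Sum.elim x b') ↔ E a x) ↔ b' = b

section

variable (L : FirstOrder.Language.{u, v}) {M : Type w} [L.Structure M]

/-! ### Algebraic and definable closure -/

/-- `acl A`: the elements that lie in a finite `A`-definable set. -/
def acl (A : Set M) : Set M := {b | ∃ S : Set M, A.Definable₁ L S ∧ S.Finite ∧ b ∈ S}

/-- `dcl A`: the elements `b` such that `{b}` is `A`-definable. -/
def dcl (A : Set M) : Set M := {b | A.Definable₁ L {b}}

/-! ### Complete types over sets of parameters, and saturation -/

/-- `S_n(A)`: the complete `n`-types over a set `A` of parameters from `M`. -/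
abbrev TypeOver (A : Set M) (n : ℕ) : Type _ :=
  (L[[A]].completeTheory M).CompleteType (Fin n)

/-- The model `M` is saturated: every complete `1`-type over a set of fewer than `#M` parameters
is realized in `M`. -/
def IsSaturated (M : Type w) [L.Structure M] [Nonempty M] : Prop :=
  ∀ A : Set M, #A < #M → ∀ p : TypeOver L A 1,
    p ∈ (L[[A]].completeTheory M).realizedTypes M (Fin 1)

variable {L}

/-- The subsets of `M ^ n` defined by the formulas that belong to the type `p`. -/
def TypeOver.sets {A : Set M} {n : ℕ} (p : TypeOver L A n) : Set (Set (Fin n → M)) :=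
  {X | ∃ φ : L[[A]].Formula (Fin n), Formula.equivSentence φ ∈ p ∧ X = {x | φ.Realize x}}

/-! ### Automorphisms and conjugates -/

/-- The image of a set of `n`-tuples under an automorphism of `M`. -/
def conj {n : ℕ} (σ : M ≃[L] M) (X : Set (Fin n → M)) : Set (Fin n → M) :=
  (fun x i => σ (x i)) '' X

variable (L)

/-- The automorphisms of `M` that fix `A` pointwise. -/
def AutFixing (A : Set M) : Set (M ≃[L] M) := {σ | ∀ a ∈ A, σ a = a}

/-- The finite tuple `e` is a canonical parameter of the definable set `X`. -/
def IsCanonicalParameter {n m : ℕ} (X : Set (Fin n → M)) (e : Fin m → M) : Prop :=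
  (Set.univ : Set M).Definable L X ∧
    ∀ σ : M ≃[L] M, conj σ X = X ↔ ∀ i, σ (e i) = e i

/-- The definable set `X` is weakly normal relative to the set `C`: it is nonempty, and every
`a ∈ X` lies in only finitely many conjugates of `X` under the automorphisms fixing `C`. -/
def WeaklyNormalRel {n : ℕ} (C : Set M) (X : Set (Fin n → M)) : Prop :=
  (Set.univ : Set M).Definable L X ∧ X.Nonempty ∧
    ∀ a ∈ X, {Y | a ∈ Y ∧ ∃ σ ∈ AutFixing L C, Y = conj σ X}.Finite

/-! ### Forking, stationary types and canonical bases

The set `A` is to be thought of as small in a saturated `M`; a "global" type is a complete type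
over all of `M`. -/

/-- The definable set `X` divides over `A`: some infinite sequence of `A`-conjugates of `X` is
`k`-inconsistent. (In a saturated model, the `A`-conjugates of the set defined by `φ (x, b)` are
the sets defined by `φ (x, b')` with `b'` realizing `tp (b / A)`.) -/
def Divides {n : ℕ} (A : Set M) (X : Set (Fin n → M)) : Prop :=
  (Set.univ : Set M).Definable L X ∧
    ∃ k : ℕ, ∃ σ : ℕ → (M ≃[L] M), (∀ i, σ i ∈ AutFixing L A) ∧
      ∀ s : Finset ℕ, s.card = k → ⋂ i ∈ s, conj (σ i) X = ∅

/-- The definable set `X` forks over `A`: it is covered by finitely many definable sets each of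
which divides over `A`. -/
def Forks {n : ℕ} (A : Set M) (X : Set (Fin n → M)) : Prop :=
  (Set.univ : Set M).Definable L X ∧
    ∃ D : Set (Set (Fin n → M)), D.Finite ∧ (∀ Y ∈ D, Divides L A Y) ∧ X ⊆ ⋃₀ D

variable {L}

/-- The type `q` over `B` is a nonforking extension of the type `p` over `A`. -/
def IsNonforkingExtension {A B : Set M} {n : ℕ} (p : TypeOver L A n) (q : TypeOver L B n) : Prop :=
  A ⊆ B ∧ TypeOver.sets p ⊆ TypeOver.sets q ∧ ∀ X ∈ TypeOver.sets q, ¬ Forks L A X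

/-- The type `p` is stationary: it has exactly one global nonforking extension. -/
def IsStationary {A : Set M} {n : ℕ} (p : TypeOver L A n) : Prop :=
  ∃! q : TypeOver L (Set.univ : Set M) n, IsNonforkingExtension p q

/-- The automorphism `σ` fixes the global type `q`. -/
def FixesType {n : ℕ} (σ : M ≃[L] M) (q : TypeOver L (Set.univ : Set M) n) : Prop :=
  ∀ X : Set (Fin n → M), conj σ X ∈ TypeOver.sets q ↔ X ∈ TypeOver.sets q

/-- The finite tuple `e` is the canonical base (up to interdefinability) of the stationary type
`p`: an automorphism fixes the global nonforking extension of `p` if and only if it fixes `e`. -/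
def IsCanonicalBase {A : Set M} {n m : ℕ} (p : TypeOver L A n) (e : Fin m → M) : Prop :=
  IsStationary p ∧
    ∀ q : TypeOver L (Set.univ : Set M) n, IsNonforkingExtension p q →
      ∀ σ : M ≃[L] M, FixesType σ q ↔ ∀ i, σ (e i) = e i

end

end ModelTh

/-! Saturation gives a realization `a` of `p` in `M`; let `I` index a basis of `a` over `e`. A set
is large if it has points whose `I`-coordinates are independent over any given finite set. Every set
in `p` is large, and some set in `p` has uniformly finite fibers over the `I`-coordinates. By
pigeonhole, sufficiently many large definable subsets of such a set have a common point
(`exists_mem_of_card`). Hence every global type of large sets extending `p` is nonforking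
(`isNonforkingExtension`), and stationarity makes it unique. Uniqueness yields `X₁` in `p` that does
not split into two large definable pieces (`exists_irreducible`), an analogue of Morley degree one.
If `X ⊆ X₁` is in `p` and meets its image under an automorphism in a large set, the automorphism
fixes the global type (`fixesType_of_large`), hence fixes `e`. So every such `X` has `e` as
canonical parameter.

If `a` were algebraic over its own `I`-coordinates, `X` could be chosen inside a set with finite
fibers definable without parameters. Were the orbit of some coordinate of `e` infinite, pigeonhole
would give two conjugates of `X` with large intersection but different values of that coordinate,
which is impossible; so `e` would be algebraic (`mem_acl_empty`). Hence some coordinate of `a` is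
algebraic over `e` and the `I`-coordinates but not over the latter alone.

Take `c` to be a basis of `e` over `a`, chosen among the coordinates of `e`. By exchange `e` is not
algebraic over `c` (`not_range_subset_acl`). But `e` is algebraic over `c` and `a`, so `X₁` can be
shrunk to points `x` over which `e` lies in finite `c`-definable fibers. A `c`-conjugate of `X`
through a given point is determined by a conjugate of `e` in these fibers, which is weak normality.

The automorphisms needed are extended from partial elementary maps whose domain and range span `M`
algebraically (`ElemRel.exists_aut`). -/

namespace ModelTh

/-! ### Fibers in one distinguished coordinate -/

section Fiber

variable {M : Type*}

/-- The fiber over `t` of a set `D` of tuples, in a distinguished last coordinate. -/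
def fiber {α : Type*} (D : Set (α ⊕ Fin 1 → M)) (t : α → M) : Set M :=
  {b | Sum.elim t (fun _ => b) ∈ D}

theorem mem_fiber {α : Type*} {D : Set (α ⊕ Fin 1 → M)} {t : α → M} {b : M} :
    b ∈ fiber D t ↔ Sum.elim t (fun _ => b) ∈ D := Iff.rfl

end Fiber

/-! ### Parameters, counting in fibers, and algebraic closure -/

section Definability

variable {L : FirstOrder.Language.{u, v}} {M : Type w} [L.Structure M]

/-- A formula uses finitely many parameters. Collecting them in a tuple `t` leaves a parameter-free
`D`, so automorphisms and elementary maps need only act on `t`. -/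
theorem definable_iff_exists_params {α : Type*} {A : Set M} {S : Set (α → M)} :
    A.Definable L S ↔ ∃ (k : ℕ) (t : Fin k → M) (D : Set (Fin k ⊕ α → M)),
      (∀ i, t i ∈ A) ∧ (∅ : Set M).Definable L D ∧ S = {x | Sum.elim t x ∈ D} := by
  constructor
  · intro h
    obtain ⟨A₀, hA₀, h⟩ := Set.definable_iff_finitely_definable.1 h
    obtain ⟨φ, rfl⟩ := Set.definable_iff_exists_formula_sum.1 h
    let f : Fin A₀.card ≃ (A₀ : Set M) := A₀.equivFin.symm
    refine ⟨A₀.card, fun i => f i, {x | φ.Realize (x ∘ Sum.map f.symm id)},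
      fun i => hA₀ (f i).2, ?_, ?_⟩
    · refine Set.empty_definable_iff.2 ⟨φ.relabel (Sum.map f.symm id), ?_⟩
      ext x
      simp [Formula.realize_relabel]
    · ext x
      have : Sum.elim (fun i => (f i : M)) x ∘ Sum.map f.symm id
          = Sum.elim (fun a : (A₀ : Set M) => (a : M)) x := by
        ext i
        cases i <;> simp
      simp [this]
  · rintro ⟨k, t, D, ht, hD, rfl⟩
    obtain ⟨φ, rfl⟩ := Set.empty_definable_iff.1 hD
    refine Set.definable_iff_exists_formula_sum.2
      ⟨φ.relabel (Sum.map (fun i => (⟨t i, ht i⟩ : A)) id), ?_⟩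
    ext x
    simp only [Formula.realize_relabel]
    have : Sum.elim t x = Sum.elim (fun a : A => (a : M)) x ∘
        Sum.map (fun i => (⟨t i, ht i⟩ : A)) id := by
      ext i
      cases i <;> simp
    simp [this]

theorem definable₁_fiber {α : Type*} [Finite α] {A : Set M} {D : Set (α ⊕ Fin 1 → M)}
    (hD : A.Definable L D) (t : α → M) (ht : ∀ i, t i ∈ A) : A.Definable₁ L (fiber D t) := by
  refine hD.preimage_map (F := fun x => Sum.elim t (fun _ => x 0)) ?_
  rintro (i | i)
  · exact L.definableFun_const _ (ht i)
  · exact Set.DefinableFun.proj L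

theorem definable₁_iff_exists_fiber {A : Set M} {S : Set M} :
    A.Definable₁ L S ↔ ∃ (k : ℕ) (t : Fin k → M) (D : Set (Fin k ⊕ Fin 1 → M)),
      (∀ i, t i ∈ A) ∧ (∅ : Set M).Definable L D ∧ S = fiber D t := by
  constructor
  · intro h
    obtain ⟨k, t, D, ht, hD, h⟩ := definable_iff_exists_params.1 h
    refine ⟨k, t, D, ht, hD, ?_⟩
    ext b
    exact Set.ext_iff.1 h (fun _ => b)
  · rintro ⟨k, t, D, ht, hD, rfl⟩
    exact definable₁_fiber (hD.mono (Set.empty_subset _)) t ht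

theorem lt_encard_iff_exists_injective {X : Type*} {S : Set X} {N : ℕ} :
    (N : ℕ∞) < S.encard ↔ ∃ f : Fin (N + 1) → X, (∀ i, f i ∈ S) ∧ Function.Injective f := by
  rw [← ENat.add_one_le_iff (by simp)]
  constructor
  · intro h
    obtain ⟨S', hS', hc⟩ := Set.exists_subset_encard_eq h
    have hfin : S'.Finite := Set.finite_of_encard_eq_coe (k := N + 1) (by simpa using hc)
    have hcard : Nat.card S' = N + 1 := by
      have := hfin.cast_ncard_eq
      rw [hc] at this
      rw [Nat.card_coe_set_eq]
      exact_mod_cast this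
    have := hfin.to_subtype
    let g : Fin (N + 1) ≃ S' := (finCongr hcard.symm).trans (Finite.equivFin S').symm
    exact ⟨fun i => g i, fun i => hS' (g i).2, Subtype.val_injective.comp g.injective⟩
  · rintro ⟨f, hf, hi⟩
    have h := Set.encard_le_encard (Set.range_subset_iff.2 hf)
    rw [← Set.image_univ, hi.encard_image, Set.encard_univ, ENat.card_eq_coe_fintype_card] at h
    simpa using h

/-- Having `N + 1` distinct elements is first-order, so size bounds on fibers are preserved by
elementary maps. -/
theorem definable_lt_encard_fiber {α : Type*} [Finite α] {A : Set M} {D : Set (α ⊕ Fin 1 → M)}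
    (hD : A.Definable L D) (N : ℕ) : A.Definable L {t | (N : ℕ∞) < (fiber D t).encard} := by
  have h₁ : ∀ i : Fin (N + 1), A.Definable L
      {x : α ⊕ Fin (N + 1) → M | x ∘ Sum.map id (fun _ => i) ∈ D} := fun i =>
    hD.preimage_comp _
  have h₂ : ∀ ij : Fin (N + 1) × Fin (N + 1), A.Definable L
      {x : α ⊕ Fin (N + 1) → M | x (Sum.inr ij.1) = x (Sum.inr ij.2) → ij.1 = ij.2} := by
    intro ij
    by_cases h : ij.1 = ij.2
    · simp [h]
    · have := (Set.DefinableFun.ofPred_eq (L := L) (A := A)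
        (f := fun x : α ⊕ Fin (N + 1) → M => x (Sum.inr ij.1))
        (g := fun x => x (Sum.inr ij.2)) (Set.DefinableFun.proj L)
        (Set.DefinableFun.proj L)).compl
      convert this using 1
      ext x
      simp [h]
  have h := ((Set.definable_iInter_of_finite h₁).inter
    (Set.definable_iInter_of_finite h₂)).exists_of_finite
  convert h using 1
  ext t
  simp only [Set.mem_ofPred_eq, lt_encard_iff_exists_injective, Set.mem_inter_iff, Set.mem_iInter,
    Sum.elim_inr, Prod.forall]
  refine exists_congr fun f => and_congr (forall_congr' fun i => ?_) Iff.rfl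
  rw [mem_fiber]
  have : Sum.elim t f ∘ Sum.map id (fun _ : Fin 1 => i) = Sum.elim t (fun _ => f i) := by
    ext j
    cases j <;> simp
  rw [this]

theorem definable_encard_fiber_le {α : Type*} [Finite α] {A : Set M} {D : Set (α ⊕ Fin 1 → M)}
    (hD : A.Definable L D) (N : ℕ) : A.Definable L {t | (fiber D t).encard ≤ N} := by
  convert (definable_lt_encard_fiber hD N).compl using 1
  ext t
  simp

/-- A definable set over `A` and a tuple `t` is a section of an `A`-definable set. -/
theorem exists_definable_section {α ι : Type*} [Finite α] {A : Set M} {t : ι → M}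
    {S : Set (α → M)} (hS : (A ∪ Set.range t).Definable L S) :
    ∃ D : Set (ι ⊕ α → M), A.Definable L D ∧ S = {x | Sum.elim t x ∈ D} := by
  classical
  obtain ⟨k, s, D, hs, hD, rfl⟩ := definable_iff_exists_params.1 hS
  have hs' : ∀ i, ∃ g : (ι ⊕ α → M) → M, A.DefinableFun L g ∧ ∀ x, g (Sum.elim t x) = s i := by
    intro i
    rcases hs i with h | ⟨j, hj⟩
    · exact ⟨fun _ => s i, L.definableFun_const _ h, fun _ => rfl⟩
    · exact ⟨fun x => x (Sum.inl j), Set.DefinableFun.proj L, fun x => hj⟩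
  choose g hg hgs using hs'
  refine ⟨(fun x => Sum.elim (fun i => g i x) (fun a => x (Sum.inr a))) ⁻¹' D,
    Set.Definable.preimage_map ?_ (hD.mono (Set.empty_subset _)), ?_⟩
  · rintro (i | a)
    · exact hg i
    · exact Set.DefinableFun.proj L
  · ext x
    simp [hgs]

theorem acl_mono {A B : Set M} (h : A ⊆ B) : acl L A ⊆ acl L B :=
  fun _ ⟨S, hS, hf, hb⟩ => ⟨S, hS.mono h, hf, hb⟩

theorem subset_acl (A : Set M) : A ⊆ acl L A := fun a ha =>
  ⟨{a}, Set.Definable.singleton_of_mem L ha, Set.finite_singleton a, rfl⟩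

theorem subset_dcl (A : Set M) : A ⊆ dcl L A := fun _ ha =>
  Set.Definable.singleton_of_mem L ha

/-- Empty every fiber that is larger than the one over `t`; the fiber over `t` survives, and all
fibers become uniformly bounded. -/
theorem exists_bounded_of_finite_fiber {α : Type*} [Finite α] {A : Set M}
    {D : Set (α ⊕ Fin 1 → M)} (hD : A.Definable L D) {t : α → M} (hf : (fiber D t).Finite) :
    ∃ (D' : Set (α ⊕ Fin 1 → M)) (N : ℕ), A.Definable L D' ∧ fiber D' t = fiber D t ∧
      ∀ s, (fiber D' s).encard ≤ N := by
  have hN : (fiber D t).encard ≤ hf.toFinset.card := by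
    rw [hf.encard_eq_coe_toFinset_card]
  refine ⟨D ∩ {x | (fiber D (x ∘ Sum.inl)).encard ≤ hf.toFinset.card}, hf.toFinset.card,
    hD.inter ((definable_encard_fiber_le hD _).preimage_comp Sum.inl), ?_, fun s => ?_⟩
  · ext b
    simp [mem_fiber, hN]
  · by_cases h : (fiber D s).encard ≤ hf.toFinset.card
    · refine (Set.encard_le_encard fun b hb => ?_).trans h
      exact hb.1
    · rw [Set.encard_eq_zero.2]
      · exact zero_le
      · refine Set.eq_empty_iff_forall_notMem.2 fun b hb => h ?_
        simpa using hb.2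

/-- An element algebraic over `A` and `t` lies in the fiber over `t` of an `A`-definable set all of
whose fibers have bounded size. -/
theorem exists_bounded_fiber {ι : Type*} [Finite ι] {A : Set M} {t : ι → M} {b : M}
    (hb : b ∈ acl L (A ∪ Set.range t)) :
    ∃ (D : Set (ι ⊕ Fin 1 → M)) (N : ℕ), A.Definable L D ∧ b ∈ fiber D t ∧
      ∀ s, (fiber D s).encard ≤ N := by
  obtain ⟨S, hS, hf, hbS⟩ := hb
  obtain ⟨D, hD, h⟩ := exists_definable_section hS
  have hSD : S = fiber D t := by
    ext b
    exact Set.ext_iff.1 h (fun _ => b)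
  subst hSD
  obtain ⟨D', N, hD', hfib, hN⟩ := exists_bounded_of_finite_fiber hD hf
  exact ⟨D', N, hD', hfib ▸ hbS, hN⟩

/-- Let the algebraic parameters `t` range over a finite `A`-definable set of tuples. Because the
fibers are bounded for every tuple, not only for `t`, their union is still finite. -/
theorem acl_acl (A : Set M) : acl L (acl L A) ⊆ acl L A := by
  rintro b ⟨S, hS, hf, hb⟩
  obtain ⟨k, t, D, ht, hD, rfl⟩ := definable₁_iff_exists_fiber.1 hS
  obtain ⟨D', N, hD', hfib, hN⟩ := exists_bounded_of_finite_fiber hD hf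
  rw [← hfib] at hb
  choose S hS hSf htS using ht
  refine ⟨{b | ∃ s : Fin k → M, (∀ i, s i ∈ S i) ∧ b ∈ fiber D' s}, ?_, ?_, t, htS, hb⟩
  · have h₁ : A.Definable L {x : Fin 1 ⊕ Fin k → M | ∀ i, x (Sum.inr i) ∈ S i} := by
      rw [Set.ofPred_forall]
      exact Set.definable_iInter_of_finite fun i => (hS i).preimage_comp fun _ => Sum.inr i
    have h₂ : A.Definable L ((fun x : Fin 1 ⊕ Fin k → M => x ∘ Sum.swap) ⁻¹' D') :=
      (hD'.mono (Set.empty_subset _)).preimage_comp _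
    unfold Set.Definable₁
    convert (h₁.inter h₂).exists_of_finite using 1
    ext x
    refine exists_congr fun s => and_congr Iff.rfl ?_
    rw [mem_fiber]
    have : Sum.elim s (fun _ => x 0) = Sum.elim x s ∘ (Sum.swap : Fin k ⊕ Fin 1 → _) := by
      ext j
      rcases j with j | j
      · simp
      · simp [Subsingleton.elim j 0]
    rw [this]
    rfl
  · refine ((Set.Finite.pi' hSf).biUnion (t := fun s => fiber D' s)
      fun s _ => Set.finite_of_encard_le_coe (hN s)).subset ?_
    rintro c ⟨s, hs, hc⟩
    exact Set.mem_biUnion (x := s) hs hc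

theorem acl_subset_acl {A B : Set M} (h : A ⊆ acl L B) : acl L A ⊆ acl L B :=
  (acl_mono h).trans (acl_acl B)

theorem exists_finite_mem_acl {A : Set M} {b : M} (hb : b ∈ acl L A) :
    ∃ A₀ : Set M, A₀.Finite ∧ A₀ ⊆ A ∧ b ∈ acl L A₀ := by
  obtain ⟨S, hS, hf, hb⟩ := hb
  obtain ⟨A₀, hA₀, h⟩ := Set.definable_iff_finitely_definable.1 hS
  exact ⟨A₀, A₀.finite_toSet, hA₀, S, h, hf, hb⟩

theorem exists_finite_definable {α : Type*} {A : Set M} {S : Set (α → M)}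
    (hS : A.Definable L S) : ∃ A₀ : Set M, A₀.Finite ∧ A₀ ⊆ A ∧ A₀.Definable L S := by
  obtain ⟨A₀, hA₀, h⟩ := Set.definable_iff_finitely_definable.1 hS
  exact ⟨A₀, A₀.finite_toSet, hA₀, h⟩

/-! ### Automorphisms and definable sets -/

theorem aut_mem_iff_of_definable_empty {α : Type*} {D : Set (α → M)}
    (hD : (∅ : Set M).Definable L D) (σ : M ≃[L] M) (x : α → M) :
    (fun i => σ (x i)) ∈ D ↔ x ∈ D := by
  obtain ⟨φ, rfl⟩ := Set.empty_definable_iff.1 hD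
  exact StrongHomClass.realize_formula σ φ

theorem aut_mem_iff {α : Type*} {A : Set M} {S : Set (α → M)} (hS : A.Definable L S)
    {σ : M ≃[L] M} (hσ : σ ∈ AutFixing L A) (x : α → M) :
    (fun i => σ (x i)) ∈ S ↔ x ∈ S := by
  obtain ⟨k, t, D, ht, hD, rfl⟩ := definable_iff_exists_params.1 hS
  rw [Set.mem_ofPred_eq, Set.mem_ofPred_eq]
  have : Sum.elim t (fun i => σ (x i)) = fun i => σ (Sum.elim t x i) := by
    ext i
    rcases i with i | i
    · exact (hσ _ (ht i)).symm
    · rfl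
  rw [this, aut_mem_iff_of_definable_empty hD σ]

theorem mem_conj {n : ℕ} {σ : M ≃[L] M} {X : Set (Fin n → M)} {x : Fin n → M} :
    x ∈ conj σ X ↔ (fun i => σ.symm (x i)) ∈ X := by
  constructor
  · rintro ⟨y, hy, rfl⟩
    simpa using hy
  · intro h
    exact ⟨_, h, by simp⟩

theorem conj_eq_self {n : ℕ} {A : Set M} {S : Set (Fin n → M)} (hS : A.Definable L S)
    {σ : M ≃[L] M} (hσ : σ ∈ AutFixing L A) : conj σ S = S := by
  ext x
  rw [mem_conj, ← aut_mem_iff hS hσ]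
  simp

theorem definable_conj {n : ℕ} {A : Set M} {S : Set (Fin n → M)} (hS : A.Definable L S)
    (σ : M ≃[L] M) : (σ '' A).Definable L (conj σ S) := by
  obtain ⟨k, t, D, ht, hD, rfl⟩ := definable_iff_exists_params.1 hS
  refine definable_iff_exists_params.2
    ⟨k, fun i => σ (t i), D, fun i => ⟨_, ht i, rfl⟩, hD, ?_⟩
  ext x
  rw [mem_conj, Set.mem_ofPred_eq, Set.mem_ofPred_eq, ← aut_mem_iff_of_definable_empty hD σ]
  have : Sum.elim (fun i => σ (t i)) x =
      fun i => σ (Sum.elim t (fun i => σ.symm (x i)) i) := by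
    ext i
    rcases i with i | i <;> simp
  rw [this]

theorem aut_mem_acl {A : Set M} {b : M} (hb : b ∈ acl L A) (σ : M ≃[L] M) :
    σ b ∈ acl L (σ '' A) := by
  obtain ⟨S, hS, hf, hb⟩ := hb
  refine ⟨σ '' S, ?_, hf.image σ, ⟨b, hb, rfl⟩⟩
  have := definable_conj hS σ
  unfold Set.Definable₁
  convert this using 1
  ext x
  rw [mem_conj]
  constructor
  · rintro ⟨y, hy, hyx⟩
    simpa [← hyx] using hy
  · intro h
    exact ⟨_, h, by simp⟩

theorem aut_mem_acl_iff {A : Set M} {b : M} (σ : M ≃[L] M) :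
    σ b ∈ acl L (σ '' A) ↔ b ∈ acl L A := by
  refine ⟨fun h => ?_, fun h => aut_mem_acl h σ⟩
  have := aut_mem_acl h σ.symm
  simpa [Set.image_image] using this

/-- An automorphism maps conjugates to conjugates. -/
theorem conj_comp {n : ℕ} (σ τ : M ≃[L] M) (X : Set (Fin n → M)) :
    conj (σ.comp τ) X = conj σ (conj τ X) := by
  simp [conj, Set.image_image]

end Definability

/-! ### Extending partial elementary maps to automorphisms -/

section ElemRel

variable (L : FirstOrder.Language.{u, v}) {M : Type w} [L.Structure M]

/-- The relation `R` is (the graph of) a partial elementary map. -/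
def ElemRel (R : Set (M × M)) : Prop :=
  ∀ (k : ℕ) (D : Set (Fin k → M)), (∅ : Set M).Definable L D → ∀ t : Fin k → M × M,
    (∀ i, t i ∈ R) → ((fun i => (t i).1) ∈ D ↔ (fun i => (t i).2) ∈ D)

variable {L} {R : Set (M × M)}

theorem ElemRel.mem_iff (hR : ElemRel L R) {α : Type*} [Finite α] {D : Set (α → M)}
    (hD : (∅ : Set M).Definable L D) {t : α → M × M} (ht : ∀ i, t i ∈ R) :
    (fun i => (t i).1) ∈ D ↔ (fun i => (t i).2) ∈ D := by
  have e := Finite.equivFin α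
  have := hR _ ((fun x : Fin (Nat.card α) → M => x ∘ e) ⁻¹' D) (hD.preimage_comp e)
    (fun i => t (e.symm i)) (fun i => ht _)
  simpa [Function.comp_def] using this

theorem ElemRel.swap (hR : ElemRel L R) : ElemRel L (Prod.swap '' R) := by
  intro k D hD t ht
  have := hR k D hD (fun i => (t i).swap) fun i => by
    obtain ⟨x, hx, h⟩ := ht i
    simpa [← h] using hx
  exact this.symm

theorem elemRel_diag (C : Set M) : ElemRel L ((fun x => (x, x)) '' C) := by
  intro k D hD t ht
  have : (fun i => (t i).1) = fun i => (t i).2 := by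
    ext i
    obtain ⟨x, hx, h⟩ := ht i
    simp [← h]
  rw [this]

theorem ElemRel.encard_fiber_le (hR : ElemRel L R) {α : Type*} [Finite α]
    {D : Set (α ⊕ Fin 1 → M)} (hD : (∅ : Set M).Definable L D) {t : α → M × M}
    (ht : ∀ i, t i ∈ R) (N : ℕ) :
    (fiber D fun i => (t i).1).encard ≤ N ↔ (fiber D fun i => (t i).2).encard ≤ N :=
  hR.mem_iff (definable_encard_fiber_le hD N) ht

theorem ElemRel.finite_fiber (hR : ElemRel L R) {α : Type*} [Finite α]
    {D : Set (α ⊕ Fin 1 → M)} (hD : (∅ : Set M).Definable L D) {t : α → M × M}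
    (ht : ∀ i, t i ∈ R) (h : (fiber D fun i => (t i).1).Finite) :
    (fiber D fun i => (t i).2).Finite := by
  refine Set.finite_of_encard_le_coe ((hR.encard_fiber_le hD ht h.toFinset.card).1 ?_)
  rw [h.encard_eq_coe_toFinset_card]

/-- One implication suffices: applied to the complement of `D` it gives the converse. -/
theorem ElemRel.insert_of_fiber {d d' : M}
    (h : ∀ (α : Type) [Finite α] (D : Set (α ⊕ Fin 1 → M)), (∅ : Set M).Definable L D →
      ∀ t : α → M × M, (∀ i, t i ∈ R) → d ∈ fiber D (fun i => (t i).1) →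
        d' ∈ fiber D fun i => (t i).2) :
    ElemRel L (insert (d, d') R) := by
  classical
  intro k D hD t ht
  let f : Fin k → {i // t i ∈ R} ⊕ Fin 1 := fun i =>
    if h : t i ∈ R then Sum.inl ⟨i, h⟩ else Sum.inr 0
  have hf₁ : (Sum.elim (fun i : {i // t i ∈ R} => (t i).1) fun _ => d) ∘ f =
      fun i => (t i).1 := by
    ext i
    by_cases hi : t i ∈ R
    · simp [f, hi]
    · simp only [f, Function.comp_apply, dif_neg hi, Sum.elim_inr]
      rw [(ht i).resolve_right hi]
  have hf₂ : (Sum.elim (fun i : {i // t i ∈ R} => (t i).2) fun _ => d') ∘ f =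
      fun i => (t i).2 := by
    ext i
    by_cases hi : t i ∈ R
    · simp [f, hi]
    · simp only [f, Function.comp_apply, dif_neg hi, Sum.elim_inr]
      rw [(ht i).resolve_right hi]
  have key : ∀ D : Set (Fin k → M), (∅ : Set M).Definable L D →
      (fun i => (t i).1) ∈ D → (fun i => (t i).2) ∈ D := by
    intro D hD hm
    have := h {i // t i ∈ R} ((fun x => x ∘ f) ⁻¹' D) (hD.preimage_comp f) (fun i => t i)
      (fun i => i.2)
    rw [mem_fiber, mem_fiber, Set.mem_preimage, Set.mem_preimage, hf₁, hf₂] at this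
    exact this hm
  refine ⟨key D hD, fun hm => ?_⟩
  by_contra hm'
  exact key _ hD.compl hm' hm

/-- There is only one nonalgebraic 1-type: a definable set over the domain containing `d` must be
cofinite, and cofiniteness transfers to the range, so `d'` cannot avoid the corresponding set. -/
theorem ElemRel.insert_generic
    (hfc : ∀ S : Set M, (Set.univ : Set M).Definable₁ L S → S.Finite ∨ Sᶜ.Finite)
    (hR : ElemRel L R) {d d' : M} (hd : d ∉ acl L (Prod.fst '' R))
    (hd' : d' ∉ acl L (Prod.snd '' R)) : ElemRel L (insert (d, d') R) := by
  refine ElemRel.insert_of_fiber fun α _ D hD t ht hm => ?_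
  rcases hfc _ (definable₁_fiber (hD.mono (Set.empty_subset _)) (fun i => (t i).1)
    fun _ => trivial) with hf | hf
  · exact absurd ⟨_, definable₁_fiber (hD.mono (Set.empty_subset _)) (fun i => (t i).1)
      fun i => ⟨_, ht i, rfl⟩, hf, hm⟩ hd
  · by_contra hm'
    exact hd' ⟨fiber Dᶜ fun i => (t i).2,
      definable₁_fiber (hD.compl.mono (Set.empty_subset _)) (fun i => (t i).2)
      fun i => ⟨_, ht i, rfl⟩, hR.finite_fiber hD.compl ht hf, hm'⟩

/-- The smallest finite set over the domain containing `d` isolates the type of `d`; any element of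
the corresponding set over the range is a valid image. -/
theorem ElemRel.exists_insert (hR : ElemRel L R) {d : M} (hd : d ∈ acl L (Prod.fst '' R)) :
    ∃ d', ElemRel L (insert (d, d') R) := by
  classical
  let P : ℕ → Prop := fun N => ∃ (α : Type) (_ : Finite α) (D : Set (α ⊕ Fin 1 → M))
    (t : α → M × M), (∅ : Set M).Definable L D ∧ (∀ i, t i ∈ R) ∧
    (d ∈ fiber D fun i => (t i).1) ∧ (fiber D fun i => (t i).1).encard = N
  have hP : ∃ N, P N := by
    obtain ⟨S, hS, hf, hd⟩ := hd
    obtain ⟨k, t, D, ht, hD, rfl⟩ := definable₁_iff_exists_fiber.1 hS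
    choose t' ht' htt' using ht
    obtain rfl : (fun i => (t' i).1) = t := funext htt'
    exact ⟨hf.toFinset.card, Fin k, inferInstance, D, t', hD, ht', hd,
      hf.encard_eq_coe_toFinset_card⟩
  obtain ⟨α, _, D, t, hD, ht, hdD, hN⟩ := Nat.find_spec hP
  have hmin := fun N => Nat.find_min (m := N) hP
  generalize Nat.find hP = N at hN hmin
  have hne : (fiber D fun i => (t i).2).Nonempty := by
    by_contra h
    have h₀ := (hR.encard_fiber_le hD ht 0).2 (by simp [Set.not_nonempty_iff_eq_empty.1 h])
    simp only [Nat.cast_zero, nonpos_iff_eq_zero, Set.encard_eq_zero] at h₀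
    simp [h₀] at hdD
  obtain ⟨d', hd'⟩ := hne
  refine ⟨d', ElemRel.insert_of_fiber fun β _ E hE s hs hm => ?_⟩
  -- `F true` is `D ∩ E`, used against minimality to put the fiber of `D` inside that of `E`. `F
  -- false` is `D \ E`, whose empty fiber carries this inclusion to the range.
  let F : Bool → Set ((α ⊕ β) ⊕ Fin 1 → M) := fun c =>
    (fun x => x ∘ Sum.map Sum.inl id) ⁻¹' D ∩
      (fun x => x ∘ Sum.map Sum.inr id) ⁻¹' (bif c then E else Eᶜ)
  have hF : ∀ c, (∅ : Set M).Definable L (F c) := fun c =>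
    (hD.preimage_comp _).inter (Set.Definable.preimage_comp _ (by cases c; exacts [hE.compl, hE]))
  have hfib : ∀ (c : Bool) (x : α → M) (y : β → M), fiber (F c) (Sum.elim x y) =
      fiber D x ∩ fiber (bif c then E else Eᶜ) y := by
    intro c x y
    ext b
    simp only [mem_fiber, F, Set.mem_inter_iff, Set.mem_preimage, Sum.elim_comp_map,
      Sum.elim_comp_inl, Sum.elim_comp_inr, Function.comp_id]
  have hts : ∀ i, Sum.elim t s i ∈ R := by
    rintro (i | i)
    exacts [ht i, hs i]
  have h₁ : (fun i => (Sum.elim t s i).1) = Sum.elim (fun i => (t i).1) fun i => (s i).1 := by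
    ext i; cases i <;> rfl
  have h₂ : (fun i => (Sum.elim t s i).2) = Sum.elim (fun i => (t i).2) fun i => (s i).2 := by
    ext i; cases i <;> rfl
  have hsub : fiber D (fun i => (t i).1) ⊆ fiber E fun i => (s i).1 := by
    have hfin : (fiber D fun i => (t i).1).Finite := Set.finite_of_encard_eq_coe hN
    have hle : (fiber D (fun i => (t i).1) ∩ fiber E fun i => (s i).1) = _ :=
      (hfib true (fun i => (t i).1) (fun i => (s i).1)).symm
    have hfin' := hfin.subset (Set.inter_subset_left (t := fiber E fun i => (s i).1))
    by_contra hns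
    have hlt : hfin'.toFinset.card < N := by
      have : (fiber D (fun i => (t i).1) ∩ fiber E fun i => (s i).1).encard < _ :=
        hfin'.encard_lt_encard
          (Set.inter_subset_left.ssubset_of_ne fun h => hns (Set.inter_eq_left.1 h))
      rw [hN, hfin'.encard_eq_coe_toFinset_card] at this
      exact_mod_cast this
    refine hmin _ hlt ⟨α ⊕ β, inferInstance, F true, Sum.elim t s, hF true, hts, ?_, ?_⟩
    · rw [h₁, hfib]
      exact ⟨hdD, hm⟩
    · rw [h₁, ← hle, hfin'.encard_eq_coe_toFinset_card]
  have h₀ : (fiber (F false) fun i => (Sum.elim t s i).1).encard ≤ (0 : ℕ) := by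
    rw [h₁, hfib]
    have : fiber D (fun i => (t i).1) ∩ fiber Eᶜ (fun i => (s i).1) = ∅ :=
      Set.eq_empty_iff_forall_notMem.2 fun x hx => hx.2 (hsub hx.1)
    simpa using this
  have := (hR.encard_fiber_le (hF false) hts 0).1 h₀
  rw [h₂, hfib] at this
  simp only [Nat.cast_zero, nonpos_iff_eq_zero, Set.encard_eq_zero] at this
  by_contra hm'
  have : d' ∈ (∅ : Set M) := this ▸ ⟨hd', hm'⟩
  exact this

theorem ElemRel.exists_maximal (hR : ElemRel L R) :
    ∃ R', R ⊆ R' ∧ Maximal (ElemRel L) R' := by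
  refine zorn_subset_nonempty {R | ElemRel L R} (fun c hc hch hne => ?_) R hR
  refine ⟨⋃₀ c, fun k D hD t ht => ?_, fun s hs => Set.subset_sUnion_of_mem hs⟩
  obtain ⟨R', hR', h⟩ := DirectedOn.exists_mem_subset_of_finite_of_subset_sUnion hne
    hch.directedOn (Set.finite_range t) (Set.range_subset_iff.2 ht)
  exact hc hR' k D hD t fun i => h ⟨i, rfl⟩

/-- A maximal elementary extension is total and surjective, since every element is algebraic over
both domain and range. Preservation of equality makes it the graph of a bijection. -/
theorem ElemRel.exists_aut (hR : ElemRel L R) (h₁ : ∀ x, x ∈ acl L (Prod.fst '' R))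
    (h₂ : ∀ x, x ∈ acl L (Prod.snd '' R)) : ∃ σ : M ≃[L] M, ∀ p ∈ R, σ p.1 = p.2 := by
  obtain ⟨R', hRR', hmax⟩ := hR.exists_maximal
  have hR' := hmax.prop
  have hfst : ∀ x, ∃ y, (x, y) ∈ R' := by
    intro x
    obtain ⟨y, hy⟩ := hR'.exists_insert (acl_mono (Set.image_mono hRR') (h₁ x))
    exact ⟨y, hmax.le_of_ge hy (Set.subset_insert _ _) (Set.mem_insert _ _)⟩
  have hsnd : ∀ y, ∃ x, (x, y) ∈ R' := by
    intro y
    obtain ⟨x, hx⟩ := hR'.swap.exists_insert (d := y) (by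
      have : Prod.fst '' (Prod.swap '' R') = Prod.snd '' R' := by
        simp [Set.image_image]
      rw [this]
      exact acl_mono (Set.image_mono hRR') (h₂ y))
    have hx := hx.swap
    rw [Set.image_insert_eq, Set.image_image] at hx
    simp only [Prod.swap_prod_mk, Prod.swap_swap, Set.image_id'] at hx
    exact ⟨x, hmax.le_of_ge hx (Set.subset_insert _ _) (Set.mem_insert _ _)⟩
  have heq : ∀ p ∈ R', ∀ q ∈ R', p.1 = q.1 ↔ p.2 = q.2 := by
    intro p hp q hq
    have := hR' 2 {x | x 0 = x 1} (Set.DefinableFun.ofPred_eq (Set.DefinableFun.proj L)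
      (Set.DefinableFun.proj L)) ![p, q] (by
        intro i
        fin_cases i
        exacts [hp, hq])
    simpa using this
  choose f hf using hfst
  have hbij : Function.Bijective f := by
    refine ⟨fun x y hxy => (heq _ (hf x) _ (hf y)).2 hxy, fun y => ?_⟩
    obtain ⟨x, hx⟩ := hsnd y
    exact ⟨x, (heq _ (hf x) _ hx).1 rfl⟩
  let g : M ↪ₑ[L] M := ⟨f, fun n φ x => by
    have := hR' n {x | φ.Realize x} (Set.empty_definable_iff.2 ⟨φ, rfl⟩)
      (fun i => (x i, f (x i))) fun i => hf _
    exact this.symm⟩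
  let σ : M ≃[L] M :=
    { toEquiv := Equiv.ofBijective f hbij
      map_fun' := fun φ x => g.toEmbedding.map_fun φ x
      map_rel' := fun r x => g.toEmbedding.map_rel r x }
  exact ⟨σ, fun p hp => (heq _ (hf p.1) _ (hRR' hp)).1 rfl⟩

end ElemRel

/-! ### Exchange and homogeneity -/

section Pregeometry

variable {L : FirstOrder.Language.{u, v}} {M : Type w} [L.Structure M]

theorem insert_eq_union_range (a : M) (C : Set M) :
    insert a C = C ∪ Set.range (fun _ : Fin 1 => a) := by
  rw [Set.range_const, Set.union_singleton]

/-- The exchange property of algebraic closure in a strongly minimal structure. -/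
theorem acl_exchange [Infinite M]
    (hfc : ∀ S : Set M, (Set.univ : Set M).Definable₁ L S → S.Finite ∨ Sᶜ.Finite)
    {C : Set M} {a b : M} (hb : b ∈ acl L (insert a C)) (hbC : b ∉ acl L C) :
    a ∈ acl L (insert b C) := by
  rw [insert_eq_union_range] at hb
  obtain ⟨D, N, hD, hbD, hN⟩ := exists_bounded_fiber hb
  have hD' : C.Definable L ((fun x : Fin 1 ⊕ Fin 1 → M => x ∘ Sum.swap) ⁻¹' D) :=
    hD.preimage_comp _
  set E := (fun x : Fin 1 ⊕ Fin 1 → M => x ∘ Sum.swap) ⁻¹' D with hE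
  have hED : ∀ x y, y ∈ fiber E (fun _ => x) ↔ x ∈ fiber D (fun _ => y) := by
    intro x y
    simp only [hE, mem_fiber, Set.mem_preimage]
    have : (Sum.elim (fun _ => x) (fun _ => y)) ∘ (Sum.swap : Fin 1 ⊕ Fin 1 → _) =
        Sum.elim (fun _ => y) (fun _ => x) := by
      ext i
      cases i <;> rfl
    rw [this]
  rcases hfc _ (definable₁_fiber (hD'.mono (Set.subset_univ _)) (fun _ => b) fun _ => trivial)
    with hf | hf
  · exact ⟨_, definable₁_fiber (hD'.mono (Set.subset_insert b C)) (fun _ => b)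
      fun _ => Set.mem_insert _ _, hf, (hED b a).2 hbD⟩
  -- Infinitely many `x` omit at most as many points from `fiber E x` as `b` does, since this
  -- condition is `C`-definable and `b ∉ acl C`. Any `y` in the fibers over `N + 1` of them gives a
  -- fiber of `D` with more than `N` elements.
  · exfalso
    set K := hf.toFinset.card
    have hdef : C.Definable₁ L {x | (fiber Eᶜ (fun _ : Fin 1 => x)).encard ≤ K} := by
      unfold Set.Definable₁
      convert definable_encard_fiber_le hD'.compl K using 1
      ext x
      have : (fun _ => x 0) = x := by
        ext i
        rw [Subsingleton.elim i 0]
      simp [this]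
    have hinf : ¬ {x | (fiber Eᶜ (fun _ : Fin 1 => x)).encard ≤ K}.Finite := fun hfin =>
      hbC ⟨_, hdef, hfin, hf.encard_eq_coe_toFinset_card.le⟩
    have hlt : (N : ℕ∞) < {x | (fiber Eᶜ (fun _ : Fin 1 => x)).encard ≤ K}.encard := by
      rw [Set.Infinite.encard_eq hinf]
      exact ENat.natCast_lt_top N
    obtain ⟨f, hf, hfi⟩ := lt_encard_iff_exists_injective.1 hlt
    have hfinU : (⋃ i, fiber Eᶜ (fun _ : Fin 1 => f i)).Finite :=
      Set.finite_iUnion fun i => Set.finite_of_encard_le_coe (hf i)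
    obtain ⟨y, hy⟩ := hfinU.exists_notMem
    simp only [Set.mem_iUnion, not_exists] at hy
    refine absurd (lt_encard_iff_exists_injective.2 ⟨f, fun i => ?_, hfi⟩)
      (hN fun _ => y).not_gt
    rw [← hED]
    by_contra h
    exact hy i h

theorem mem_acl_insert_mono {a : M} {A B : Set M} (h : A ⊆ B) :
    acl L (insert a A) ⊆ acl L (insert a B) := acl_mono (Set.insert_subset_insert h)

/-- Enlarge `B` to a maximal `C` over which `b` and `b'` stay independent. Then `C`, `b` and `b'`
span `M`, and the map swapping `b` with `b'` over `C` is elementary, so it extends to an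
automorphism. -/
theorem exists_aut_of_notMem_acl_insert [Infinite M]
    (hfc : ∀ S : Set M, (Set.univ : Set M).Definable₁ L S → S.Finite ∨ Sᶜ.Finite)
    {B : Set M} {b b' : M} (hb : b ∉ acl L B) (hb' : b' ∉ acl L (insert b B)) :
    ∃ σ ∈ AutFixing L B, σ b = b' := by
  have hbb' : b ∉ acl L (insert b' B) := fun h => hb' (acl_exchange hfc h hb)
  have hchain : ∀ (c : Set (Set M)) (x y : M), IsChain (· ⊆ ·) c → c.Nonempty →
      x ∈ acl L (insert y (⋃₀ c)) → ∃ C ∈ c, x ∈ acl L (insert y C) := by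
    intro c x y hc hne hx
    obtain ⟨A, hAf, hA, hx⟩ := exists_finite_mem_acl hx
    obtain ⟨C, hC, hAC⟩ := DirectedOn.exists_mem_subset_of_finite_of_subset_sUnion hne
      hc.directedOn (hAf.sdiff (t := {y})) (fun z hz => (hA hz.1).resolve_left hz.2)
    refine ⟨C, hC, acl_mono (fun z hz => ?_) hx⟩
    by_cases hzy : z = y
    · exact Or.inl hzy
    · exact Or.inr (hAC ⟨hz, hzy⟩)
  obtain ⟨C, hBC, hC⟩ := zorn_subset_nonempty
    {C | b ∉ acl L (insert b' C) ∧ b' ∉ acl L (insert b C)} (fun c hc hch hne =>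
      ⟨⋃₀ c, ⟨fun h => by
        obtain ⟨C, hC, h⟩ := hchain c _ _ hch hne h
        exact (hc hC).1 h, fun h => by
        obtain ⟨C, hC, h⟩ := hchain c _ _ hch hne h
        exact (hc hC).2 h⟩, fun s hs => Set.subset_sUnion_of_mem hs⟩) B ⟨hbb', hb'⟩
  obtain ⟨hbC, hbC'⟩ := hC.prop
  -- By exchange, an element outside this closure could be added to `C` without destroying the
  -- independence.
  have hspan : ∀ d, d ∈ acl L (insert b' (insert b C)) := by
    intro d
    by_contra hd
    have hdC : d ∉ C := fun h => hd (subset_acl _ (Or.inr (Or.inr h)))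
    refine hdC (hC.le_of_ge (y := insert d C) ⟨fun h => ?_, fun h => ?_⟩
      (Set.subset_insert _ _) (Set.mem_insert _ _))
    · rw [Set.insert_comm] at h
      have := acl_exchange hfc h hbC
      rw [Set.insert_comm] at this
      exact hd this
    · rw [Set.insert_comm] at h
      exact hd (acl_exchange hfc h hbC')
  have himg₁ : Prod.fst '' ((fun x => (x, x)) '' C) = C := by simp [Set.image_image]
  have himg₂ : Prod.snd '' ((fun x => (x, x)) '' C) = C := by simp [Set.image_image]
  have hmono : ∀ x, acl L C ⊆ acl L (insert x C) := fun x => acl_mono (Set.subset_insert _ _)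
  have hR₁ : ElemRel L (insert (b, b') ((fun x => (x, x)) '' C)) :=
    (elemRel_diag C).insert_generic hfc (by rw [himg₁]; exact fun h => hbC (hmono _ h))
      (by rw [himg₂]; exact fun h => hbC' (hmono _ h))
  have hR₂ : ElemRel L (insert (b', b) (insert (b, b') ((fun x => (x, x)) '' C))) :=
    hR₁.insert_generic hfc (by rwa [Set.image_insert_eq, himg₁])
      (by rwa [Set.image_insert_eq, himg₂])
  obtain ⟨σ, hσ⟩ := hR₂.exists_aut
    (by rw [Set.image_insert_eq, Set.image_insert_eq, himg₁]; exact hspan)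
    (by rw [Set.image_insert_eq, Set.image_insert_eq, himg₂, Set.insert_comm]; exact hspan)
  exact ⟨σ, fun a ha => hσ (a, a) (Or.inr (Or.inr ⟨a, hBC ha, rfl⟩)),
    hσ (b, b') (Or.inr (Or.inl rfl))⟩

theorem comp_mem_autFixing {A : Set M} {σ τ : M ≃[L] M} (hσ : σ ∈ AutFixing L A)
    (hτ : τ ∈ AutFixing L A) : σ.comp τ ∈ AutFixing L A := fun a ha => by
  rw [Equiv.comp_apply, hτ a ha, hσ a ha]

theorem symm_mem_autFixing {A : Set M} {σ : M ≃[L] M} (hσ : σ ∈ AutFixing L A) :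
    σ.symm ∈ AutFixing L A := fun a ha => by
  conv_lhs => rw [← hσ a ha]
  exact σ.symm_apply_apply a

variable (L M) in
/-- A strongly minimal structure which is not algebraic over a finite set. -/
structure InfiniteDimensional : Prop where
  infinite : Infinite M
  finite_or_cofinite : ∀ S : Set M, (Set.univ : Set M).Definable₁ L S → S.Finite ∨ Sᶜ.Finite
  exists_notMem_acl : ∀ B : Set M, B.Finite → ∃ b, b ∉ acl L B

namespace InfiniteDimensional

theorem exchange (hM : InfiniteDimensional L M) {C : Set M} {a b : M}
    (hb : b ∈ acl L (insert a C)) (hbC : b ∉ acl L C) :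
    a ∈ acl L (insert b C) :=
  have := hM.infinite
  acl_exchange hM.finite_or_cofinite hb hbC

/-- The elements `b` and `b'` may be interalgebraic over `B`; passing through a third element `c`,
independent of both, reduces to the independent case. -/
theorem exists_aut (hM : InfiniteDimensional L M) {B : Set M} (hB : B.Finite) {b b' : M}
    (hb : b ∉ acl L B)    (hb' : b' ∉ acl L B) : ∃ σ ∈ AutFixing L B, σ b = b' := by
  have := hM.infinite
  obtain ⟨c, hc⟩ := hM.exists_notMem_acl (insert b (insert b' B)) ((hB.insert _).insert _)
  obtain ⟨σ, hσ, hσb⟩ := exists_aut_of_notMem_acl_insert hM.finite_or_cofinite hb (b' := c)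
    fun h => hc (mem_acl_insert_mono (Set.subset_insert _ _) h)
  obtain ⟨τ, hτ, hτb⟩ := exists_aut_of_notMem_acl_insert hM.finite_or_cofinite hb' (b' := c)
    fun h => hc (acl_mono (Set.subset_insert _ _) h)
  exact ⟨τ.symm.comp σ, comp_mem_autFixing (symm_mem_autFixing hτ) hσ, by
    rw [Equiv.comp_apply, hσb, ← hτb, τ.symm_apply_apply]⟩

/-- An element whose orbit is finite is algebraic. -/
theorem mem_acl_of_finite_orbit (hM : InfiniteDimensional L M) {B : Set M} (hB : B.Finite)
    {b : M}
    (h : {x | ∃ σ ∈ AutFixing L B, σ b = x}.Finite) : b ∈ acl L B := by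
  by_contra hb
  obtain ⟨c, hc⟩ := hM.exists_notMem_acl (B ∪ {x | ∃ σ ∈ AutFixing L B, σ b = x}) (hB.union h)
  obtain ⟨σ, hσ, hσb⟩ := hM.exists_aut hB hb fun h => hc (acl_mono Set.subset_union_left h)
  exact hc (subset_acl _ (Or.inr ⟨σ, hσ, hσb⟩))

end InfiniteDimensional

/-! ### Independent tuples and large sets -/

variable (L) in
/-- The coordinates of `x` in `I` are (successively) independent over `B`. -/
def Indep {n : ℕ} (I : Set (Fin n)) (B : Set M) (x : Fin n → M) : Prop :=
  ∀ i ∈ I, x i ∉ acl L (B ∪ x '' {j ∈ I | j < i})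

theorem Indep.mono {n : ℕ} {I : Set (Fin n)} {B B' : Set M} {x : Fin n → M}
    (h : Indep L I B' x) (hB : B ⊆ B') : Indep L I B x := fun i hi hx =>
  h i hi (acl_mono (Set.union_subset_union_left _ hB) hx)

theorem Indep.congr {n : ℕ} {I : Set (Fin n)} {B : Set M} {x y : Fin n → M}
    (h : Indep L I B x) (hxy : ∀ i ∈ I, x i = y i) : Indep L I B y := by
  intro i hi
  have : y '' {j ∈ I | j < i} = x '' {j ∈ I | j < i} :=
    Set.image_congr fun j hj => (hxy j hj.1).symm
  rw [this, ← hxy i hi]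
  exact h i hi

theorem Indep.aut {n : ℕ} {I : Set (Fin n)} {B : Set M} {x : Fin n → M}
    (h : Indep L I B x) (σ : M ≃[L] M) : Indep L I (σ '' B) fun i => σ (x i) := by
  intro i hi hx
  refine h i hi ((aut_mem_acl_iff σ).1 ?_)
  rwa [Set.image_union, Set.image_image]

theorem InfiniteDimensional.exists_aut_of_indep (hM : InfiniteDimensional L M) {n : ℕ}
    {I : Set (Fin n)} {B : Set M} (hB : B.Finite) {x y : Fin n → M} (hx : Indep L I B x)
    (hy : Indep L I B y) : ∃ σ ∈ AutFixing L B, ∀ i ∈ I, σ (x i) = y i := by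
  suffices h : ∀ k ≤ n, ∃ σ ∈ AutFixing L B, ∀ i ∈ I, (i : ℕ) < k → σ (x i) = y i by
    obtain ⟨σ, hσ, h⟩ := h n le_rfl
    exact ⟨σ, hσ, fun i hi => h i hi i.2⟩
  intro k
  induction k with
  | zero =>
    exact fun _ => ⟨FirstOrder.Language.Equiv.refl L M, fun _ _ => rfl,
      fun i _ h => absurd h (by simp)⟩
  | succ k ih =>
    intro hk
    obtain ⟨σ, hσ, h⟩ := ih (by omega)
    by_cases hkI : (⟨k, hk⟩ : Fin n) ∈ I
    · set i : Fin n := ⟨k, hk⟩ with hi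
      have himg : (fun j => σ (x j)) '' {j ∈ I | j < i} = y '' {j ∈ I | j < i} :=
        Set.image_congr fun j hj => h j hj.1 hj.2
      have hσB : σ '' B = B := by
        rw [Set.image_congr (g := id) fun b hb => hσ b hb, Set.image_id]
      have h₁ := hx.aut σ i hkI
      rw [himg, hσB] at h₁
      obtain ⟨τ, hτ, hτi⟩ := hM.exists_aut (hB.union (Set.toFinite _)) h₁ (hy i hkI)
      refine ⟨τ.comp σ, comp_mem_autFixing (fun b hb => hτ b (Or.inl hb)) hσ, ?_⟩
      intro j hj hjk
      rw [Equiv.comp_apply]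
      rcases Nat.lt_succ_iff_lt_or_eq.1 hjk with hlt | heq
      · rw [h j hj hlt]
        exact hτ _ (Or.inr ⟨j, ⟨hj, hlt⟩, rfl⟩)
      · obtain rfl : j = i := Fin.ext heq
        exact hτi
    · refine ⟨σ, hσ, fun j hj hjk => h j hj ?_⟩
      rcases Nat.lt_succ_iff_lt_or_eq.1 hjk with hlt | heq
      · exact hlt
      · exact absurd (by convert hj; exact heq.symm) hkI

variable (L) in
/-- The set `Y` contains points whose coordinates in `I` are independent over any given finite
set of parameters. -/
def Large {n : ℕ} (I : Set (Fin n)) (Y : Set (Fin n → M)) : Prop :=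
  ∀ B : Set M, B.Finite → ∃ y ∈ Y, Indep L I B y

theorem Large.mono {n : ℕ} {I : Set (Fin n)} {X Y : Set (Fin n → M)} (h : Large L I X)
    (hXY : X ⊆ Y) : Large L I Y := fun B hB =>
  let ⟨y, hy, hi⟩ := h B hB
  ⟨y, hXY hy, hi⟩

/-- Finite parameter sets witnessing smallness can be united, so the small sets form an ideal. -/
theorem Large.or_of_union {n : ℕ} {I : Set (Fin n)} {X Y : Set (Fin n → M)}
    (h : Large L I (X ∪ Y)) : Large L I X ∨ Large L I Y := by
  by_contra! hn
  obtain ⟨h₁, h₂⟩ := hn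
  unfold Large at h₁ h₂
  push Not at h₁ h₂
  obtain ⟨B₁, hB₁, h₁⟩ := h₁
  obtain ⟨B₂, hB₂, h₂⟩ := h₂
  obtain ⟨y, hy | hy, hi⟩ := h (B₁ ∪ B₂) (hB₁.union hB₂)
  · exact h₁ y hy (hi.mono Set.subset_union_left)
  · exact h₂ y hy (hi.mono Set.subset_union_right)

theorem Large.conj {n : ℕ} {I : Set (Fin n)} {X : Set (Fin n → M)}
    (h : Large L I X) (σ : M ≃[L] M) : Large L I (conj σ X) := by
  intro B hB
  obtain ⟨y, hy, hi⟩ := h (σ.symm '' B) (hB.image _)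
  refine ⟨_, ⟨y, hy, rfl⟩, ?_⟩
  have := hi.aut σ
  simpa [Set.image_image] using this

/-- A definable set containing one point with independent coordinates over its parameters meets
the fiber over every such point. -/
theorem InfiniteDimensional.exists_mem_of_indep (hM : InfiniteDimensional L M) {n : ℕ}
    {I : Set (Fin n)} {B : Set M} (hB : B.Finite) {Y : Set (Fin n → M)} (hY : B.Definable L Y)
    {x y : Fin n → M} (hx : Indep L I B x) (hy : Indep L I B y) (hyY : y ∈ Y) :
    ∃ z ∈ Y, ∀ i ∈ I, z i = x i := by
  obtain ⟨σ, hσ, h⟩ := hM.exists_aut_of_indep hB hy hx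
  exact ⟨_, (aut_mem_iff hY hσ y).2 hyY, h⟩

theorem InfiniteDimensional.exists_indep (hM : InfiniteDimensional L M) {n : ℕ}
    (I : Set (Fin n)) {B : Set M} (hB : B.Finite) : ∃ x : Fin n → M, Indep L I B x := by
  have hne : Nonempty M := hM.infinite.nonempty
  suffices h : ∀ k ≤ n, ∃ x : Fin n → M, Indep L {i ∈ I | (i : ℕ) < k} B x by
    obtain ⟨x, hx⟩ := h n le_rfl
    simp only [Fin.is_lt, and_true] at hx
    exact ⟨x, hx⟩
  intro k
  induction k with
  | zero => exact fun _ => ⟨fun _ => Classical.arbitrary M, fun i hi => absurd hi.2 (by simp)⟩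
  | succ k ih =>
    intro hk
    obtain ⟨x, hx⟩ := ih (by omega)
    obtain ⟨b, hb⟩ := hM.exists_notMem_acl (B ∪ Set.range x) (hB.union (Set.finite_range x))
    refine ⟨Function.update x ⟨k, hk⟩ b, fun i hi => ?_⟩
    have himg : Function.update x ⟨k, hk⟩ b '' {j | j ∈ {i ∈ I | (i : ℕ) < k + 1} ∧ j < i} =
        x '' {j | j ∈ {i ∈ I | (i : ℕ) < k + 1} ∧ j < i} := by
      refine Set.image_congr fun j hj => Function.update_of_ne (fun h => ?_) _ _
      have h₁ := Fin.lt_def.1 hj.2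
      have h₂ := hi.2
      rw [h] at h₁
      simp at h₁
      omega
    rw [himg]
    rcases Nat.lt_succ_iff_lt_or_eq.1 hi.2 with hlt | heq
    · rw [Function.update_of_ne (by rintro rfl; simp at hlt)]
      refine fun h => hx i ⟨hi.1, hlt⟩ (acl_mono (Set.union_subset_union_right _
        (Set.image_mono ?_)) h)
      exact fun j hj => ⟨⟨hj.1.1, (Fin.lt_def.1 hj.2).trans hlt⟩, hj.2⟩
    · obtain rfl : i = ⟨k, hk⟩ := Fin.ext heq
      rw [Function.update_self]
      exact fun h => hb (acl_mono (Set.union_subset_union_right _ (Set.image_subset_range _ _)) h)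

/-- A definable set containing a point with independent coordinates over its parameters is
large. -/
theorem InfiniteDimensional.large_of_mem (hM : InfiniteDimensional L M) {n : ℕ}
    {I : Set (Fin n)} {B : Set M} (hB : B.Finite) {Y : Set (Fin n → M)} (hY : B.Definable L Y)
    {y : Fin n → M} (hy : Indep L I B y) (hyY : y ∈ Y) : Large L I Y := by
  intro C hC
  obtain ⟨x, hx⟩ := hM.exists_indep I (hB.union hC)
  obtain ⟨z, hz, hzx⟩ := hM.exists_mem_of_indep hB hY (hx.mono Set.subset_union_left) hy hyY
  exact ⟨z, hz, (hx.mono Set.subset_union_right).congr fun i hi => (hzx i hi).symm⟩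

/-- The members of a sequence of large definable subsets of a set with fibers of size at most `N`
have a common point, with independent coordinates, as soon as there are enough of them. -/
theorem InfiniteDimensional.exists_mem_of_card (hM : InfiniteDimensional L M) {n : ℕ}
    {I : Set (Fin n)} {Z : Set (Fin n → M)} {N : ℕ}
    (hZ : ∀ x : Fin n → M, {z ∈ Z | ∀ i ∈ I, z i = x i}.encard ≤ N) {Y : ℕ → Set (Fin n → M)}
    (hYZ : ∀ i, Y i ⊆ Z) (hdef : ∀ i, (Set.univ : Set M).Definable L (Y i))
    (hY : ∀ i, Large L I (Y i)) (k : ℕ) {B : Set M} (hB : B.Finite) :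
    ∃ y, Indep L I B y ∧ ∃ s : Finset ℕ, (∀ i ∈ s, i < N * k + 1) ∧ s.card = k + 1 ∧
      ∀ i ∈ s, y ∈ Y i := by
  classical
  choose C hCf _ hC using fun i => exists_finite_definable (hdef i)
  -- A point `x` independent over all parameters involved is generic for each `Y i` simultaneously,
  -- so each of these sets meets the fiber over `x`.
  let C' : Set M := B ∪ ⋃ i ∈ Finset.range (N * k + 1), C i
  have hC' : C'.Finite := hB.union ((Finset.finite_toSet _).biUnion fun i _ => hCf i)
  obtain ⟨x, hx⟩ := hM.exists_indep I hC'
  have hsub : ∀ i ∈ Finset.range (N * k + 1), C i ⊆ C' := fun i hi =>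
    (Set.subset_biUnion_of_mem (u := fun i => C i) hi).trans Set.subset_union_right
  have hpt : ∀ i : ℕ, ∃ z, i ∈ Finset.range (N * k + 1) → z ∈ Y i ∧ ∀ j ∈ I, z j = x j := by
    intro i
    by_cases hi : i ∈ Finset.range (N * k + 1)
    · obtain ⟨y, hy, hyi⟩ := hY i (C i) (hCf i)
      obtain ⟨z, hz⟩ := hM.exists_mem_of_indep (hCf i) (hC i) (hx.mono (hsub i hi)) hyi hy
      exact ⟨z, fun _ => hz⟩
    · exact ⟨x, fun h => absurd h hi⟩
  choose z hz using hpt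
  have hfin : {z ∈ Z | ∀ i ∈ I, z i = x i}.Finite := Set.finite_of_encard_le_coe (hZ x)
  have hcard : hfin.toFinset.card ≤ N := by
    have := hZ x
    rw [hfin.encard_eq_coe_toFinset_card] at this
    exact_mod_cast this
  -- Here `N * k + 1` indices are sent into a fiber of at most `N` points, so more than `k` share a
  -- point.
  obtain ⟨y, hy, hlt⟩ := Finset.exists_lt_card_fiber_of_mul_lt_card_of_maps_to
    (s := Finset.range (N * k + 1)) (t := hfin.toFinset) (f := z) (n := k)
    (fun i hi => by
      rw [Set.Finite.mem_toFinset]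
      exact ⟨hYZ i (hz i hi).1, (hz i hi).2⟩) (by
      rw [Finset.card_range]
      exact Nat.lt_succ_of_le (Nat.mul_le_mul_right k hcard))
  obtain ⟨s, hs, hsc⟩ := Finset.exists_subset_card_eq (Nat.succ_le_of_lt hlt)
  refine ⟨y, ?_, s, fun i hi => ?_, hsc, fun i hi => ?_⟩
  · rw [Set.Finite.mem_toFinset] at hy
    exact (hx.mono Set.subset_union_left).congr fun i hi => (hy.2 i hi).symm
  · exact Finset.mem_range.1 (Finset.mem_filter.1 (hs hi)).1
  · have := Finset.mem_filter.1 (hs hi)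
    exact this.2 ▸ (hz i this.1).1

end Pregeometry

/-! ### Complete types as ultrafilters, and saturation -/

theorem exists_ultrafilter_of_inter {X : Type*} {S : Set (Set X)} (hS : S.Nonempty)
    (hinter : ∀ A ∈ S, ∀ B ∈ S, A ∩ B ∈ S) (hne : ∀ A ∈ S, A.Nonempty) :
    ∃ U : Ultrafilter X, ∀ A ∈ S, A ∈ U := by
  let F : Filter X :=
    { sets := {A | ∃ B ∈ S, B ⊆ A}
      univ_sets := ⟨_, hS.some_mem, Set.subset_univ _⟩
      sets_of_superset := fun ⟨B, hB, h⟩ h' => ⟨B, hB, h.trans h'⟩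
      inter_sets := fun ⟨B, hB, h⟩ ⟨B', hB', h'⟩ =>
        ⟨_, hinter B hB B' hB', Set.inter_subset_inter h h'⟩ }
  have : F.NeBot := Filter.forall_mem_nonempty_iff_neBot.1 fun A ⟨B, hB, h⟩ => (hne B hB).mono h
  exact ⟨Ultrafilter.of F, fun A hA => Ultrafilter.of_le F ⟨A, hA, subset_rfl⟩⟩

section Types

variable {L : FirstOrder.Language.{u, v}} {M : Type w} [L.Structure M] [Nonempty M]

theorem exists_typeOver_of_ultrafilter (A : Set M) {n : ℕ} (U : Ultrafilter (Fin n → M)) :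
    ∃ q : TypeOver L A n, ∀ X, X ∈ TypeOver.sets q ↔ A.Definable L X ∧ X ∈ U := by
  classical
  let S : L[[A]][[Fin n]].Theory :=
    {ψ | {x | (Formula.equivSentence.symm ψ).Realize x} ∈ U}
  have hsat : {p : TypeOver L A n | S ⊆ ↑p} ≠ ∅ := by
    rw [Ne, Theory.CompleteType.setOfPred_subset_eq_empty_iff, not_not,
      Theory.isSatisfiable_iff_isFinitelySatisfiable]
    intro T₀ hT₀
    have hU : ⋂ ψ ∈ (T₀ : Set _) ∩ S, {x | (Formula.equivSentence.symm ψ).Realize x} ∈ U :=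
      (Filter.biInter_mem (T₀.finite_toSet.inter_of_left S)).2 fun ψ hψ => hψ.2
    obtain ⟨x, hx⟩ := U.nonempty_of_mem hU
    refine ((L[[A]].completeTheory M).typeOf x).isMaximal.1.mono fun ψ hψ => ?_
    rcases hT₀ hψ with h | h
    · exact ((L[[A]].completeTheory M).typeOf x).subset h
    · exact Theory.CompleteType.mem_typeOf.2 (Set.mem_iInter₂.1 hx ψ ⟨hψ, h⟩)
  obtain ⟨q, hq⟩ := Set.nonempty_iff_ne_empty.2 hsat
  have hmem : ∀ φ : L[[A]].Formula (Fin n),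
      Formula.equivSentence φ ∈ q ↔ {x | φ.Realize x} ∈ U := by
    intro φ
    refine ⟨fun h => ?_, fun h => hq (by simpa [S] using h)⟩
    by_contra hU
    have h' : (Formula.equivSentence φ).not ∈ q := by
      refine hq ?_
      change {x | (Formula.equivSentence.symm (Formula.equivSentence φ).not).Realize x} ∈ U
      rw [← Ultrafilter.compl_mem_iff_notMem] at hU
      convert hU using 1
      ext x
      rw [Set.mem_ofPred_eq, ← Theory.CompleteType.mem_typeOf (T := L[[A]].completeTheory M),
        Theory.CompleteType.not_mem_iff, Theory.CompleteType.formula_mem_typeOf]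
      rfl
    exact (Theory.CompleteType.not_mem_iff _ _).1 h' h
  refine ⟨q, fun X => ?_⟩
  constructor
  · rintro ⟨φ, hφ, rfl⟩
    exact ⟨⟨φ, rfl⟩, (hmem φ).1 hφ⟩
  · rintro ⟨⟨φ, rfl⟩, hX⟩
    exact ⟨φ, (hmem φ).2 hX, rfl⟩

/-- The type is realized in some model `N`; by completeness of the theory its formulas are
satisfiable in `M`, so the sets they define there have the finite intersection property. -/
theorem exists_ultrafilter_of_typeOver {M : Type w} [L.Structure M] {A : Set M} {n : ℕ}
    (p : TypeOver L A n) :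
    ∃ U : Ultrafilter (Fin n → M), ∀ X, X ∈ TypeOver.sets p ↔ A.Definable L X ∧ X ∈ U := by
  obtain ⟨N, v, rfl⟩ := Theory.exists_modelType_is_realized_in _ p
  have htransfer : ∀ φ : L[[A]].Formula (Fin n), φ.Realize v → ∃ x : Fin n → M, φ.Realize x := by
    intro φ hφ
    let ψ : L[[A]].Sentence := (φ.relabel (Sum.inr : Fin n → Empty ⊕ Fin n)).iExs (Fin n)
    have hN : (N : Type _) ⊨ ψ := by
      simp only [ψ, Sentence.Realize, Formula.realize_iExs, Formula.realize_relabel]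
      exact ⟨v, by simpa using hφ⟩
    have hM : M ⊨ ψ := by
      by_contra h
      have h' : ψ.not ∈ L[[A]].completeTheory M := (Sentence.realize_not M).2 h
      exact (Sentence.realize_not N).1 (N.is_model.realize_of_mem _ h') hN
    simp only [ψ, Sentence.Realize, Formula.realize_iExs, Formula.realize_relabel] at hM
    obtain ⟨x, hx⟩ := hM
    exact ⟨x, by simpa using hx⟩
  obtain ⟨U, hU⟩ := exists_ultrafilter_of_inter
    (S := TypeOver.sets ((L[[A]].completeTheory M).typeOf v)) ⟨_, ⊤, by simp, rfl⟩ (by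
      rintro _ ⟨φ, hφ, rfl⟩ _ ⟨ψ, hψ, rfl⟩
      refine ⟨φ ⊓ ψ, ?_, ?_⟩
      · rw [Theory.CompleteType.formula_mem_typeOf] at *
        exact Formula.realize_inf.2 ⟨hφ, hψ⟩
      · ext x
        simp) (by
      rintro _ ⟨φ, hφ, rfl⟩
      exact htransfer φ (Theory.CompleteType.formula_mem_typeOf.1 hφ))
  refine ⟨U, fun X => ⟨fun h => ⟨?_, hU X h⟩, ?_⟩⟩
  · obtain ⟨φ, _, rfl⟩ := h
    exact ⟨φ, rfl⟩
  · rintro ⟨⟨φ, rfl⟩, h⟩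
    refine ⟨φ, ?_, rfl⟩
    rw [Theory.CompleteType.formula_mem_typeOf]
    by_contra hφ
    have := hU _ ⟨φ.not, Theory.CompleteType.formula_mem_typeOf.2 (Formula.realize_not.2 hφ), rfl⟩
    have hc : {x : Fin n → M | φ.not.Realize x} = {x | φ.Realize x}ᶜ := by
      ext x
      simp
    rw [hc] at this
    exact Ultrafilter.compl_mem_iff_notMem.1 this h

theorem IsSaturated.exists_mem_of_ultrafilter_one (hM : IsSaturated L M) {A : Set M}
    (hA : #A < #M) (U : Ultrafilter (Fin 1 → M)) :
    ∃ a, ∀ X, A.Definable L X → X ∈ U → a ∈ X := by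
  obtain ⟨q, hq⟩ := exists_typeOver_of_ultrafilter (L := L) A U
  obtain ⟨a, rfl⟩ := hM A hA q
  refine ⟨a, fun X hX hXU => ?_⟩
  obtain ⟨φ, hφ, rfl⟩ := (hq X).2 ⟨hX, hXU⟩
  exact Theory.CompleteType.formula_mem_typeOf.1 hφ

theorem mk_lt_of_finite {M : Type w} [Infinite M] {A : Set M} (hA : A.Finite) : #A < #M :=
  (Cardinal.lt_aleph0_iff_set_finite.2 hA).trans_le (Cardinal.aleph0_le_mk M)

/-- Saturation for 1-types gives the first coordinate; the others are realized over `A` together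
with it, and the parameter set remains finite. -/
theorem IsSaturated.exists_mem_of_ultrafilter [Infinite M] (hM : IsSaturated L M) {n : ℕ}
    {A : Set M} (hA : A.Finite) (U : Ultrafilter (Fin n → M)) :
    ∃ a, ∀ X, A.Definable L X → X ∈ U → a ∈ X := by
  induction n generalizing A with
  | zero =>
    refine ⟨Fin.elim0, fun X _ hX => ?_⟩
    obtain ⟨x, hx⟩ := U.nonempty_of_mem hX
    rwa [Subsingleton.elim Fin.elim0 x]
  | succ n ih =>
    obtain ⟨b, hb⟩ := hM.exists_mem_of_ultrafilter_one (mk_lt_of_finite hA)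
      (U.map fun x => fun _ : Fin 1 => x 0)
    obtain ⟨U', hU'⟩ := exists_ultrafilter_of_inter
      (S := {X | ∃ Y, A.Definable L Y ∧ Y ∈ U ∧ X = {x : Fin n → M | Fin.cons (b 0) x ∈ Y}})
      ⟨_, Set.univ, Set.definable_univ, Filter.univ_mem, rfl⟩ (by
        rintro _ ⟨Y, hY, hYU, rfl⟩ _ ⟨Z, hZ, hZU, rfl⟩
        exact ⟨_, hY.inter hZ, Filter.inter_mem hYU hZU, rfl⟩) (by
        rintro _ ⟨Y, hY, hYU, rfl⟩
        have hdef : A.Definable L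
            {v : Fin 1 → M | ∃ x : Fin n → M, Sum.elim v x ∈
              (fun y : Fin 1 ⊕ Fin n → M => (Fin.cons (y (Sum.inl 0)) fun i => y (Sum.inr i) :
                Fin (n + 1) → M)) ⁻¹' Y} := by
          refine Set.Definable.exists_of_finite (Set.Definable.preimage_map (fun i => ?_) hY)
          refine Fin.cases ?_ (fun i => ?_) i
          · exact Set.DefinableFun.proj L
          · exact Set.DefinableFun.proj L
        obtain ⟨x, hx⟩ := hb _ hdef (Ultrafilter.mem_map.2 <| Filter.mem_of_superset hYU
          fun (y : Fin (n + 1) → M) hy => ⟨fun i => y i.succ, by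
            have : (Fin.cons (y 0) fun i : Fin n => y i.succ : Fin (n + 1) → M) = y :=
              Fin.cons_self_tail y
            simpa [this] using hy⟩)
        exact ⟨x, by simpa using hx⟩)
    obtain ⟨a, ha⟩ := ih (hA.insert (b 0)) U'
    refine ⟨Fin.cons (b 0) a, fun Y hY hYU => ?_⟩
    refine ha {x | Fin.cons (b 0) x ∈ Y} ?_ (hU' _ ⟨Y, hY, hYU, rfl⟩)
    refine Set.Definable.preimage_map (F := fun x => Fin.cons (b 0) x) (fun i => ?_)
      (hY.mono (Set.subset_insert _ _))
    refine Fin.cases ?_ (fun i => ?_) i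
    · exact L.definableFun_const _ (Set.mem_insert _ _)
    · exact Set.DefinableFun.proj L

/-- A realization over `B` of a nonprincipal ultrafilter avoids every finite `B`-definable set. -/
theorem IsSaturated.infiniteDimensional [Infinite M] (hM : IsSaturated L M)
    (hfc : ∀ S : Set M, (Set.univ : Set M).Definable₁ L S → S.Finite ∨ Sᶜ.Finite) :
    InfiniteDimensional L M where
  infinite := inferInstance
  finite_or_cofinite := hfc
  exists_notMem_acl B hB := by
    obtain ⟨b, hb⟩ := hM.exists_mem_of_ultrafilter_one (mk_lt_of_finite hB)
      ((Filter.hyperfilter M).map fun b => fun _ : Fin 1 => b)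
    refine ⟨b 0, fun ⟨S, hS, hf, hbS⟩ => ?_⟩
    exact hb _ hS.compl (Filter.compl_mem_hyperfilter_of_finite hf) hbS

/-- A family of large sets closed under intersection extends to an ultrafilter of large sets. -/
theorem exists_ultrafilter_large {M : Type w} [L.Structure M] {n : ℕ} {I : Set (Fin n)}
    {S : Set (Set (Fin n → M))}
    (hS : S.Nonempty) (hinter : ∀ A ∈ S, ∀ B ∈ S, A ∩ B ∈ S) (hlarge : ∀ A ∈ S, Large L I A) :
    ∃ U : Ultrafilter (Fin n → M), (∀ A ∈ S, A ∈ U) ∧ ∀ X ∈ U, Large L I X := by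
  -- Removing the small sets `Z` in advance keeps them out of `U`; what remains of a large set is
  -- nonempty because small sets form an ideal.
  obtain ⟨U, hU⟩ := exists_ultrafilter_of_inter
    (S := {X | ∃ A ∈ S, ∃ Z, ¬ Large L I Z ∧ X = A \ Z})
    (by
      obtain ⟨A, hA⟩ := hS
      exact ⟨_, A, hA, ∅, fun h => by simpa using h ∅ Set.finite_empty, rfl⟩)
    (by
      rintro _ ⟨A, hA, Y, hY, rfl⟩ _ ⟨B, hB, Z, hZ, rfl⟩
      refine ⟨_, hinter A hA B hB, Y ∪ Z, fun h => h.or_of_union.elim hY hZ, ?_⟩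
      ext x
      simp only [Set.mem_inter_iff, Set.mem_sdiff, Set.mem_union]
      tauto)
    (by
      rintro _ ⟨A, hA, Z, hZ, rfl⟩
      have : Large L I (A \ Z) := by
        refine Large.or_of_union (X := A \ Z) (Y := Z) ?_ |>.resolve_right hZ
        exact (hlarge A hA).mono fun x hx => by by_cases h : x ∈ Z <;> simp [h, hx]
      obtain ⟨y, hy, _⟩ := this ∅ Set.finite_empty
      exact ⟨y, hy⟩)
  have hS' : ∀ A ∈ S, A ∈ U := fun A hA => by
    refine hU _ ⟨A, hA, ∅, fun h => ?_, (Set.sdiff_empty).symm⟩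
    simpa using h ∅ Set.finite_empty
  refine ⟨U, hS', fun X hX => ?_⟩
  by_contra hXl
  obtain ⟨A, hA⟩ := hS
  have := U.nonempty_of_mem (Filter.inter_mem hX (hU _ ⟨A, hA, X, hXl, rfl⟩))
  obtain ⟨x, hx⟩ := this
  exact hx.2.2 hx.1

end Types

/-! ### Bases of tuples -/

section Bases

variable {L : FirstOrder.Language.{u, v}} {M : Type w} [L.Structure M]

variable (L) in
/-- The indices of the coordinates of `x` that are not algebraic over `B` and the previous ones. -/
def basisIndices {n : ℕ} (B : Set M) (x : Fin n → M) : Set (Fin n) :=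
  {i | x i ∉ acl L (B ∪ x '' {j | j < i})}

theorem indep_basisIndices {n : ℕ} (B : Set M) (x : Fin n → M) :
    Indep L (basisIndices L B x) B x := fun _ hi h =>
  hi (acl_mono (Set.union_subset_union_right _ (Set.image_mono fun _ hj => hj.2)) h)

theorem mem_acl_basisIndices {n : ℕ} (B : Set M) (x : Fin n → M) (i : Fin n) :
    x i ∈ acl L (B ∪ x '' basisIndices L B x) := by
  induction i using WellFoundedLT.induction with
  | _ i ih =>
    by_cases hi : i ∈ basisIndices L B x
    · exact subset_acl _ (Or.inr ⟨i, hi, rfl⟩)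
    · refine acl_subset_acl (Set.union_subset ?_ ?_) (not_not.1 hi)
      · exact Set.subset_union_left.trans (subset_acl _)
      · rintro _ ⟨j, hj, rfl⟩
        exact ih j hj

/-- A tuple algebraic over `C` and its coordinates in `I` lies in a `C`-definable set whose fibers
over the coordinates in `I` have bounded size. -/
theorem exists_bounded_of_mem_acl {n : ℕ} {I : Set (Fin n)} {C : Set M} {a : Fin n → M}
    (ha : ∀ i, a i ∈ acl L (C ∪ a '' I)) :
    ∃ (X : Set (Fin n → M)) (N : ℕ), C.Definable L X ∧ a ∈ X ∧
      ∀ x : Fin n → M, {z ∈ X | ∀ i ∈ I, z i = x i}.encard ≤ N := by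
  have h : ∀ i, a i ∈ acl L (C ∪ Set.range fun j : I => a j) := by
    intro i
    have : (Set.range fun j : I => a j) = a '' I := by
      rw [Set.image_eq_range]
    rw [this]
    exact ha i
  choose D N hD haD hN using fun i => exists_bounded_fiber (h i)
  refine ⟨{z | ∀ i, z i ∈ fiber (D i) fun j : I => z j}, ∏ i, N i, ?_, haD, fun x => ?_⟩
  · rw [Set.ofPred_forall]
    refine Set.definable_iInter_of_finite fun i => ?_
    refine (hD i).preimage_map
      (F := fun z : Fin n → M => Sum.elim (fun j : I => z j) fun _ => z i) ?_
    rintro (j | j)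
    · exact Set.DefinableFun.proj L
    · exact Set.DefinableFun.proj L
  · have hfin : ∀ i, (fiber (D i) fun j : I => x j).Finite := fun i =>
      Set.finite_of_encard_le_coe (hN i _)
    have hsub : {z ∈ {z : Fin n → M | ∀ i, z i ∈ fiber (D i) fun j : I => z j} |
        ∀ i ∈ I, z i = x i} ⊆ (Fintype.piFinset fun i => (hfin i).toFinset : Set (Fin n → M)) := by
      rintro z ⟨hz, hzx⟩
      simp only [Finset.mem_coe, Fintype.mem_piFinset, Set.Finite.mem_toFinset]
      intro i
      have : (fun j : I => x j) = fun j : I => z j := funext fun j => (hzx j j.2).symm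
      rw [this]
      exact hz i
    refine (Set.encard_le_encard hsub).trans ?_
    rw [Set.encard_coe_eq_coe_finsetCard, Fintype.card_piFinset, Nat.cast_le]
    refine Finset.prod_le_prod' fun i _ => ?_
    have := hN i fun j : I => x j
    rw [(hfin i).encard_eq_coe_toFinset_card] at this
    exact_mod_cast this

/-- If `a` is algebraic over `e` and `a '' I`, but not over `a '' I`, then a basis of `e` over `a`
does not algebraically span `e`. -/
theorem InfiniteDimensional.not_range_subset_acl (hM : InfiniteDimensional L M) {n m : ℕ}
    {a : Fin n → M} {e : Fin m → M} {I : Set (Fin n)} {i : Fin n}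
    (hi : a i ∈ acl L (Set.range e ∪ a '' I)) (hi' : a i ∉ acl L (a '' I)) :
    ¬ Set.range e ⊆ acl L (e '' basisIndices L (Set.range a) e) := by
  intro he
  set J := basisIndices L (Set.range a) e with hJ
  -- The basis elements of `e` are added one at a time. If `e k` were the first to make `a i`
  -- algebraic, exchange would make it algebraic over `a` and its predecessors, against `k ∈ J`.
  have key : ∀ k ≤ m, a i ∉ acl L (a '' I ∪ e '' {j ∈ J | (j : ℕ) < k}) := by
    intro k
    induction k with
    | zero => simpa using hi'
    | succ k ih =>
      intro hk h
      have ih := ih (by omega)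
      by_cases hkJ : (⟨k, hk⟩ : Fin m) ∈ J
      · have hins : a '' I ∪ e '' {j ∈ J | (j : ℕ) < k + 1} =
            insert (e ⟨k, hk⟩) (a '' I ∪ e '' {j ∈ J | (j : ℕ) < k}) := by
          rw [← Set.union_insert, ← Set.image_insert_eq]
          congr 2
          ext j
          simp only [Set.mem_ofPred_eq, Set.mem_insert_iff, Nat.lt_succ_iff_lt_or_eq, Fin.ext_iff]
          constructor
          · rintro ⟨hj, h | h⟩
            exacts [Or.inr ⟨hj, h⟩, Or.inl h]
          · rintro (h | ⟨hj, h⟩)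
            · exact ⟨by convert hkJ, Or.inr h⟩
            · exact ⟨hj, Or.inl h⟩
        rw [hins] at h
        refine hkJ (acl_mono ?_ (hM.exchange h ih))
        rintro _ (rfl | ⟨j, -, rfl⟩ | ⟨j, hj, rfl⟩)
        exacts [Or.inl ⟨_, rfl⟩, Or.inl ⟨_, rfl⟩, Or.inr ⟨j, hj.2, rfl⟩]
      · refine ih (acl_mono (Set.union_subset_union_right _ (Set.image_mono ?_)) h)
        intro j hj
        refine ⟨hj.1, lt_of_le_of_ne (Nat.lt_succ_iff.1 hj.2) fun h => hkJ ?_⟩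
        convert hj.1
        exact h.symm
  refine key m le_rfl (acl_subset_acl ?_ hi)
  have : {j ∈ J | (j : ℕ) < m} = J := by
    ext j
    simp
  rw [this]
  refine Set.union_subset (he.trans (acl_mono Set.subset_union_right)) ?_
  exact Set.subset_union_left.trans (subset_acl _)

end Bases

/-! ### Irreducible sets -/

section Degree

variable {L : FirstOrder.Language.{u, v}} {M : Type w} [L.Structure M]

variable (L) in
/-- The set `X` is not the union of two disjoint large definable sets. -/
def Irreducible {n : ℕ} (I : Set (Fin n)) (X : Set (Fin n → M)) : Prop :=
  ∀ Y, (Set.univ : Set M).Definable L Y → ¬ (Large L I (X ∩ Y) ∧ Large L I (X \ Y))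

theorem Irreducible.mono {n : ℕ} {I : Set (Fin n)} {X X' : Set (Fin n → M)}
    (h : Irreducible L I X) (hX : X' ⊆ X) : Irreducible L I X' := fun Y hY ⟨h₁, h₂⟩ =>
  h Y hY ⟨h₁.mono (Set.inter_subset_inter_left _ hX), h₂.mono (Set.sdiff_subset_sdiff_left hX)⟩

/-- If a family of large definable sets has a unique extension `Q` to a global type of large sets,
and one of its members has finite fibers, then some member is irreducible. -/
theorem InfiniteDimensional.exists_irreducible (hM : InfiniteDimensional L M) {n : ℕ}
    {I : Set (Fin n)} {P Q : Set (Set (Fin n → M))} (hP : P.Nonempty)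
    (hinter : ∀ X ∈ P, ∀ Y ∈ P, X ∩ Y ∈ P) (hlarge : ∀ X ∈ P, Large L I X)
    (hdef : ∀ X ∈ P, (Set.univ : Set M).Definable L X)
    (hQ : ∀ U : Ultrafilter (Fin n → M), (∀ X ∈ P, X ∈ U) → (∀ X ∈ U, Large L I X) →
      ∀ X, X ∈ Q ↔ (Set.univ : Set M).Definable L X ∧ X ∈ U)
    {X₀ : Set (Fin n → M)} {N : ℕ} (hX₀ : X₀ ∈ P)
    (hN : ∀ x : Fin n → M, {z ∈ X₀ | ∀ i ∈ I, z i = x i}.encard ≤ N) :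
    ∃ X ∈ P, Irreducible L I X := by
  classical
  -- Otherwise the sets `X \ Y` would extend to an ultrafilter of large sets omitting `Y`, although
  -- its definable sets must be exactly `Q`.
  have hsmall : ∀ Y ∈ Q, ∃ X ∈ P, ¬ Large L I (X \ Y) := by
    intro Y hY
    by_contra! hcon
    obtain ⟨U, hU, hUl⟩ := exists_ultrafilter_large (L := L) (I := I)
      (S := {Z | ∃ X ∈ P, Z = X \ Y}) (hP.elim fun X hX => ⟨_, X, hX, rfl⟩) (by
        rintro _ ⟨X, hX, rfl⟩ _ ⟨X', hX', rfl⟩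
        refine ⟨_, hinter X hX X' hX', ?_⟩
        ext x
        simp only [Set.mem_inter_iff, Set.mem_sdiff]
        tauto) (by
        rintro _ ⟨X, hX, rfl⟩
        exact hcon X hX)
    have hYU := ((hQ U (fun X hX => Filter.mem_of_superset (hU _ ⟨X, hX, rfl⟩)
      Set.sdiff_subset) hUl Y).1 hY).2
    obtain ⟨X, hX⟩ := hP
    obtain ⟨x, hx⟩ := U.nonempty_of_mem (Filter.inter_mem hYU (hU _ ⟨X, hX, rfl⟩))
    exact hx.2.2 hx.1
  have hcompl : ∀ Y, (Set.univ : Set M).Definable L Y → Y ∈ Q ∨ Yᶜ ∈ Q := by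
    intro Y hY
    obtain ⟨U, hU, hUl⟩ := exists_ultrafilter_large (L := L) (I := I) hP hinter hlarge
    rw [hQ U hU hUl, hQ U hU hUl]
    rcases U.mem_or_compl_mem Y with h | h
    exacts [Or.inl ⟨hY, h⟩, Or.inr ⟨hY.compl, h⟩]
  -- The least bound on generic fibers plays the role of Morley degree; a set attaining it will be
  -- irreducible.
  let b : ℕ → Prop := fun N => ∃ X ∈ P, ∃ B : Set M, B.Finite ∧ ∀ x, Indep L I B x →
    {z ∈ X | ∀ i ∈ I, z i = x i}.encard ≤ N
  have hb : ∃ N, b N := ⟨N, X₀, hX₀, ∅, Set.finite_empty, fun x _ => hN x⟩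
  obtain ⟨X, hX, B, hB, hXB⟩ := Nat.find_spec hb
  have hmin := fun N => Nat.find_min (m := N) hb
  generalize Nat.find hb = N at hXB hmin
  have key : ∀ Y, (Set.univ : Set M).Definable L Y → Y ∈ Q → ¬ Large L I (X \ Y) := by
    intro Y hY hYQ hl
    obtain ⟨X', hX', hX'Y⟩ := hsmall Y hYQ
    unfold Large at hX'Y
    push Not at hX'Y
    obtain ⟨B', hB', hX'Y⟩ := hX'Y
    obtain ⟨B'', hB'', -, hXY⟩ := exists_finite_definable ((hdef X hX).sdiff hY)
    -- Each generic fiber of `X` contains a point of `X \ Y`, which is outside `X'` because `X' \ Y`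
    -- has no generic points. Intersecting with `X'` thus loses a point, against minimality.
    have hlt : ∀ x, Indep L I (B ∪ B' ∪ B'') x →
        {z ∈ X ∩ X' | ∀ i ∈ I, z i = x i}.encard < N := by
      intro x hx
      have hle := hXB x (hx.mono fun b hb => Or.inl (Or.inl hb))
      obtain ⟨y, hy, hyi⟩ := hl B'' hB''
      obtain ⟨z, hz, hzx⟩ := hM.exists_mem_of_indep hB'' hXY
        (hx.mono Set.subset_union_right) hyi hy
      have hzX' : z ∉ X' := fun h => hX'Y z ⟨h, hz.2⟩
        ((hx.mono fun b hb => Or.inl (Or.inr hb)).congr fun i hi => (hzx i hi).symm)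
      have hfin : {z ∈ X ∩ X' | ∀ i ∈ I, z i = x i}.Finite :=
        (Set.finite_of_encard_le_coe hle).subset fun w hw => ⟨hw.1.1, hw.2⟩
      have hss : {z ∈ X ∩ X' | ∀ i ∈ I, z i = x i} ⊂ {z ∈ X | ∀ i ∈ I, z i = x i} :=
        ⟨fun w hw => ⟨hw.1.1, hw.2⟩, fun h => hzX' (h ⟨hz.1, hzx⟩).1.2⟩
      exact (hfin.encard_lt_encard hss).trans_le hle
    have hfin := (hB.union hB').union hB''
    obtain ⟨x, hx⟩ := hM.exists_indep I hfin
    obtain ⟨N, rfl⟩ : ∃ N', N = N' + 1 := Nat.exists_eq_succ_of_ne_zero fun h => by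
      simpa [h] using hlt x hx
    refine hmin N (Nat.lt_succ_self N) ⟨_, hinter X hX X' hX', _, hfin, fun x hx => ?_⟩
    have := hlt x hx
    rw [Nat.cast_add, Nat.cast_one] at this
    exact Order.le_of_lt_add_one this
  refine ⟨X, hX, fun Y hY ⟨h₁, h₂⟩ => ?_⟩
  rcases hcompl Y hY with h | h
  · exact key Y hY h h₂
  · refine key _ hY.compl h ?_
    rwa [Set.sdiff_compl]

end Degree

/-! ### Nonforking, automorphisms fixing the type, and weak normality -/

section Stationary

variable {L : FirstOrder.Language.{u, v}} {M : Type w} [L.Structure M]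

/-- A global type consisting of large sets and containing an `A`-definable set with finite fibers
does not fork over `A`. -/
theorem InfiniteDimensional.isNonforkingExtension (hM : InfiniteDimensional L M) {n : ℕ}
    {A : Set M} {I : Set (Fin n)} {p : TypeOver L A n}
    {q : TypeOver L (Set.univ : Set M) n} {U : Ultrafilter (Fin n → M)}
    (hpU : ∀ X ∈ TypeOver.sets p, X ∈ U) (hU : ∀ X ∈ U, Large L I X)
    (hq : ∀ X, X ∈ TypeOver.sets q ↔ (Set.univ : Set M).Definable L X ∧ X ∈ U)
    (hdef : ∀ X ∈ TypeOver.sets p, A.Definable L X)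
    {X₀ : Set (Fin n → M)} {N : ℕ} (hX₀ : X₀ ∈ TypeOver.sets p)
    (hN : ∀ x : Fin n → M, {z ∈ X₀ | ∀ i ∈ I, z i = x i}.encard ≤ N) :
    IsNonforkingExtension p q := by
  refine ⟨Set.subset_univ _, fun X hX =>
    (hq X).2 ⟨(hdef X hX).mono (Set.subset_univ _), hpU X hX⟩, ?_⟩
  rintro X hX ⟨-, D, hDf, hD, hXD⟩
  obtain ⟨Y, hYD, hYU⟩ := (Ultrafilter.finite_sUnion_mem_iff hDf).1
    (Filter.mem_of_superset ((hq X).1 hX).2 hXD)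
  obtain ⟨hY, k, σ, hσ, hinc⟩ := hD Y hYD
  have hX₀' := hdef _ hX₀
  -- Cutting `Y` down to the `A`-invariant set `X₀` keeps all its conjugates inside one set with
  -- bounded fibers, so `k` of them must meet.
  have hl : Large L I (Y ∩ X₀) := hU _ (Filter.inter_mem hYU (hpU _ hX₀))
  obtain ⟨y, -, s, -, hs, hys⟩ := hM.exists_mem_of_card hN (Y := fun i => conj (σ i) (Y ∩ X₀))
    (fun i => by
      calc conj (σ i) (Y ∩ X₀) ⊆ conj (σ i) X₀ := Set.image_mono Set.inter_subset_right
        _ = X₀ := conj_eq_self hX₀' (hσ i))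
    (fun i => (definable_conj (hY.inter (hX₀'.mono (Set.subset_univ _))) (σ i)).mono
      (Set.subset_univ _)) (fun i => hl.conj _) k (B := ∅) Set.finite_empty
  obtain ⟨t, hts, ht⟩ := Finset.exists_subset_card_eq (show k ≤ s.card by omega)
  have : y ∈ ⋂ i ∈ t, conj (σ i) Y := Set.mem_iInter₂.2 fun i hi =>
    Set.image_mono Set.inter_subset_left (hys i (hts hi))
  rw [hinc t ht] at this
  exact this

/-- An automorphism moving an irreducible set of a global type of large sets to one having a large
intersection with it fixes the type. -/
theorem fixesType_of_large {n : ℕ} {I : Set (Fin n)} {q : TypeOver L (Set.univ : Set M) n}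
    {U : Ultrafilter (Fin n → M)} (hU : ∀ X ∈ U, Large L I X)
    (hq : ∀ X, X ∈ TypeOver.sets q ↔ (Set.univ : Set M).Definable L X ∧ X ∈ U)
    {X : Set (Fin n → M)} (hX : X ∈ U) (hXd : (Set.univ : Set M).Definable L X)
    (hirr : Irreducible L I X) {σ : M ≃[L] M} (hσ : Large L I (X ∩ conj σ X)) :
    FixesType σ q := by
  have hdef : ∀ (τ : M ≃[L] M) {Y : Set (Fin n → M)}, (Set.univ : Set M).Definable L Y →
      (Set.univ : Set M).Definable L (conj τ Y) := fun τ Y hY =>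
    (definable_conj hY τ).mono (Set.subset_univ _)
  -- Irreducibility lets `X` alone determine the definable members of `U`.
  have hmem : ∀ Y, (Set.univ : Set M).Definable L Y → (Y ∈ U ↔ ¬ Large L I (X \ Y)) := by
    intro Y hY
    constructor
    · intro h hl
      exact hirr Y hY ⟨hU _ (Filter.inter_mem hX h), hl⟩
    · intro h
      by_contra hYU
      exact h (hU _ (Filter.inter_mem hX (Ultrafilter.compl_mem_iff_notMem.2 hYU)))
  have hforward : ∀ Y, (Set.univ : Set M).Definable L Y → Y ∈ U → conj σ Y ∈ U := by
    intro Y hY hYU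
    rw [hmem _ (hdef σ hY)]
    intro hl
    have hsub : X \ conj σ Y ⊆ (X \ conj σ X) ∪ conj σ (X \ Y) := by
      rintro x ⟨hx, hxY⟩
      by_cases h : x ∈ conj σ X
      · refine Or.inr (mem_conj.2 ⟨mem_conj.1 h, fun h' => hxY (mem_conj.2 h')⟩)
      · exact Or.inl ⟨hx, h⟩
    rcases (hl.mono hsub).or_of_union with h | h
    · exact hirr _ (hdef σ hXd) ⟨hσ, h⟩
    · have := h.conj σ.symm
      rw [← conj_comp] at this
      refine (hmem Y hY).1 hYU (this.mono ?_)
      intro x hx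
      simp [mem_conj] at hx
      exact hx
  intro Y
  rw [hq, hq]
  have hback : (Set.univ : Set M).Definable L (conj σ Y) → (Set.univ : Set M).Definable L Y := by
    intro h
    convert hdef σ.symm h using 1
    ext x
    simp [mem_conj]
  constructor
  · rintro ⟨hd, hm⟩
    refine ⟨hback hd, ?_⟩
    by_contra hYU
    have := hforward _ (hback hd).compl (Ultrafilter.compl_mem_iff_notMem.2 hYU)
    obtain ⟨x, hx, hx'⟩ := U.nonempty_of_mem (Filter.inter_mem hm this)
    rw [mem_conj] at hx hx'
    exact hx' hx
  · rintro ⟨hd, hm⟩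
    exact ⟨hdef σ hd, hforward Y hd hm⟩

/-- If a large irreducible set is contained in a set with finite fibers which is definable without
parameters, and `b` is fixed by all automorphisms moving it to a set having a large intersection
with it, then `b` is algebraic. -/
theorem InfiniteDimensional.mem_acl_empty (hM : InfiniteDimensional L M) {n : ℕ}
    {I : Set (Fin n)} {X Z : Set (Fin n → M)} {N : ℕ} (hXZ : X ⊆ Z)
    (hX : (Set.univ : Set M).Definable L X) (hXl : Large L I X)
    (hZ : (∅ : Set M).Definable L Z)
    (hN : ∀ x : Fin n → M, {z ∈ Z | ∀ i ∈ I, z i = x i}.encard ≤ N) {b : M}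
    (hb : ∀ σ : M ≃[L] M, Large L I (X ∩ conj σ X) → σ b = b) : b ∈ acl L (∅ : Set M) := by
  refine hM.mem_acl_of_finite_orbit Set.finite_empty ?_
  by_contra hinf
  let f := Set.Infinite.natEmbedding _ hinf
  choose σ hσ using fun i => (f i).2
  have hdef : ∀ i, (Set.univ : Set M).Definable L (conj (σ i) X) := fun i =>
    (definable_conj hX (σ i)).mono (Set.subset_univ _)
  choose C hCf _ hC using fun i => exists_finite_definable (hdef i)
  -- With `k = 1` two conjugates share a point. Independence over the parameters of all the
  -- conjugates makes that point witness a large intersection.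
  have hB : (⋃ i ∈ Finset.range (N * 1 + 1), C i).Finite :=
    (Finset.finite_toSet _).biUnion fun i _ => hCf i
  obtain ⟨y, hy, s, hs, hcard, hys⟩ := hM.exists_mem_of_card hN
    (Y := fun i => conj (σ i) X) (fun i => by
      calc conj (σ i) X ⊆ conj (σ i) Z := Set.image_mono hXZ
        _ = Z := conj_eq_self hZ (hσ i).1) hdef (fun i => hXl.conj _) 1 hB
  obtain ⟨i, hi, j, hj, hij⟩ := Finset.one_lt_card.1 (show 1 < s.card by omega)
  have hsub : ∀ i ∈ s, C i ⊆ ⋃ i ∈ Finset.range (N * 1 + 1), C i := fun i hi =>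
    Set.subset_biUnion_of_mem (u := fun i => C i) (Finset.mem_range.2 (hs i hi))
  have hl : Large L I (conj (σ i) X ∩ conj (σ j) X) :=
    hM.large_of_mem hB (((hC i).mono (hsub i hi)).inter ((hC j).mono (hsub j hj))) hy
      ⟨hys i hi, hys j hj⟩
  have hl' : Large L I (X ∩ conj ((σ i).symm.comp (σ j)) X) := by
    refine (hl.conj (σ i).symm).mono fun x hx => ?_
    rw [conj_comp]
    rw [mem_conj] at hx
    refine ⟨by simpa [mem_conj] using hx.1, ?_⟩
    rw [mem_conj]
    exact hx.2
  have h := hb _ hl'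
  rw [Equiv.comp_apply] at h
  have h' : σ j b = σ i b := by
    conv_rhs => rw [← h]
    simp
  rw [(hσ i).2, (hσ j).2] at h'
  exact hij (f.injective (Subtype.ext h')).symm

/-- A nonempty `e`-definable set is weakly normal relative to `C` if `e` lies in the finite fibers,
over each of its points, of some `C`-definable sets. -/
theorem weaklyNormalRel_of_bounded {n m : ℕ} {X : Set (Fin n → M)} {e : Fin m → M} {C : Set M}
    (hX : (Set.range e).Definable L X) (hne : X.Nonempty)
    {D : Fin m → Set (Fin n ⊕ Fin 1 → M)} (hD : ∀ j, C.Definable L (D j))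
    (hfin : ∀ j x, (fiber (D j) x).Finite) (hXD : ∀ x ∈ X, ∀ j, e j ∈ fiber (D j) x) :
    WeaklyNormalRel L C X := by
  classical
  refine ⟨hX.mono (Set.subset_univ _), hne, fun a _ => ?_⟩
  -- Since `X` is `e`-definable, its conjugate depends only on the image `t` of `e`, not on the
  -- chosen automorphism. The value `∅` for other `t` is never needed.
  let g : (Fin m → M) → Set (Fin n → M) := fun t =>
    if h : ∃ σ : M ≃[L] M, ∀ j, σ (e j) = t j then conj h.choose X else ∅
  refine ((Set.Finite.pi' fun j => hfin j a).image g).subset ?_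
  rintro Y ⟨haY, σ, hσ, rfl⟩
  refine ⟨fun j => σ (e j), fun j => ?_, ?_⟩
  · have := (aut_mem_iff (hD j) hσ _).2 (hXD _ (mem_conj.1 haY) j)
    rw [mem_fiber]
    convert this using 1
    ext i
    rcases i with i | i <;> simp
  · have h : ∃ τ : M ≃[L] M, ∀ j, τ (e j) = σ (e j) := ⟨σ, fun _ => rfl⟩
    simp only [g, dif_pos h]
    have hfix : σ.symm.comp h.choose ∈ AutFixing L (Set.range e) := by
      rintro _ ⟨j, rfl⟩
      rw [Equiv.comp_apply, h.choose_spec j, σ.symm_apply_apply]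
    have := congrArg (conj σ) (conj_eq_self hX hfix)
    rw [← conj_comp] at this
    rw [← this]
    congr 1
    ext x
    simp

end Stationary
end ModelTh

/-! ### The main theorem -/

theorem lemma3p3 {L : FirstOrder.Language.{u, v}} (T : L.Theory)
    (hT : ModelTh.StronglyMinimal.{u, v, w} T)
    (hEI : ModelTh.EliminatesImaginaries.{u, v, w} T)
    (M : Type (max u v w)) [L.Structure M] [Nonempty M] [M ⊨ T]
    (hM : ModelTh.IsSaturated L M)
    (n m : ℕ) (e : Fin m → M)
    (p : ModelTh.TypeOver L (Set.range e) n)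
    (hp : ModelTh.IsStationary p)
    (hpe : ModelTh.IsCanonicalBase p e)
    (he : ¬ Set.range e ⊆ ModelTh.acl L (∅ : Set M)) :
    ∃ X ∈ ModelTh.TypeOver.sets p,
      ModelTh.IsCanonicalParameter L X e ∧
      ∃ (l : ℕ) (c : Fin l → M),
        Set.range c ⊆ ModelTh.dcl L (Set.range e) ∧
        ¬ Set.range e ⊆ ModelTh.acl L (Set.range c) ∧
        ModelTh.WeaklyNormalRel L (Set.range c) X := by
  open ModelTh in
  obtain ⟨hinf, hfc⟩ := hT.2 (Theory.ModelType.of T M)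
  change Infinite M at hinf
  have hM' : InfiniteDimensional L M := hM.infiniteDimensional hfc
  have hefin : (Set.range e).Finite := Set.finite_range e
  obtain ⟨V, hV⟩ := exists_ultrafilter_of_typeOver p
  obtain ⟨a, ha⟩ := hM.exists_mem_of_ultrafilter hefin V
  have hP : ∀ X, X ∈ TypeOver.sets p ↔ (Set.range e).Definable L X ∧ a ∈ X := by
    intro X
    rw [hV]
    refine and_congr_right fun hX => ⟨ha X hX, fun haX => ?_⟩
    by_contra hXV
    exact ha _ hX.compl (Ultrafilter.compl_mem_iff_notMem.2 hXV) haX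
  have hPdef : ∀ X ∈ TypeOver.sets p, (Set.range e).Definable L X := fun X hX => ((hP X).1 hX).1
  have hinter : ∀ X ∈ TypeOver.sets p, ∀ Y ∈ TypeOver.sets p, X ∩ Y ∈ TypeOver.sets p := by
    intro X hX Y hY
    rw [hP] at *
    exact ⟨hX.1.inter hY.1, hX.2, hY.2⟩
  set I := basisIndices L (Set.range e) a
  have hI : Indep L I (Set.range e) a := indep_basisIndices _ _
  have hlarge : ∀ X ∈ TypeOver.sets p, Large L I X := fun X hX =>
    hM'.large_of_mem hefin (hPdef X hX) hI ((hP X).1 hX).2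
  obtain ⟨X₀, N, hX₀, haX₀, hN⟩ := 
    exists_bounded_of_mem_acl (mem_acl_basisIndices (L := L) (Set.range e) a)
  have hX₀P := (hP X₀).2 ⟨hX₀, haX₀⟩
  obtain ⟨q, hq, hquniq⟩ := hp
  -- Stationarity enters here: all extensions of `p` by large sets give the same global type `q`.
  have hQ : ∀ U : Ultrafilter (Fin n → M), (∀ X ∈ TypeOver.sets p, X ∈ U) →
      (∀ X ∈ U, Large L I X) →
      ∀ X, X ∈ TypeOver.sets q ↔ (Set.univ : Set M).Definable L X ∧ X ∈ U := by
    intro U hpU hU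
    obtain ⟨q', hq'⟩ := exists_typeOver_of_ultrafilter (L := L) Set.univ U
    rw [← hquniq q' (hM'.isNonforkingExtension hpU hU hq' hPdef hX₀P hN)]
    exact hq'
  obtain ⟨X₁, hX₁, hirr⟩ := hM'.exists_irreducible ⟨_, hX₀P⟩ hinter hlarge
    (fun X hX => (hPdef X hX).mono (Set.subset_univ _)) hQ hX₀P hN
  obtain ⟨U, hpU, hU⟩ := exists_ultrafilter_large (L := L) (I := I) ⟨_, hX₀P⟩ hinter hlarge
  have hqU := hQ U hpU hU
  have hfix : ∀ X ∈ TypeOver.sets p, X ⊆ X₁ → ∀ σ : M ≃[L] M, Large L I (X ∩ conj σ X) →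
      ∀ j, σ (e j) = e j := fun X hX hXX₁ σ hσ =>
    (hpe.2 q hq σ).1 (fixesType_of_large hU hqU (hpU X hX)
      ((hPdef X hX).mono (Set.subset_univ _)) (hirr.mono hXX₁) hσ)
  -- This is where nonalgebraicity of `e` is used.
  have hai : ∃ i, a i ∉ acl L (a '' I) := by
    by_contra! hcon
    obtain ⟨Z, N', hZ, haZ, hN'⟩ := exists_bounded_of_mem_acl (L := L) (C := ∅) (I := I) (a := a)
      (by simpa using hcon)
    have hXP : X₁ ∩ Z ∈ TypeOver.sets p :=
      hinter _ hX₁ _ ((hP Z).2 ⟨hZ.mono (Set.empty_subset _), haZ⟩)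
    refine he ?_
    rintro _ ⟨j, rfl⟩
    exact hM'.mem_acl_empty Set.inter_subset_right ((hPdef _ hXP).mono (Set.subset_univ _))
      (hlarge _ hXP) hZ hN' fun σ hσ => hfix _ hXP Set.inter_subset_left σ hσ j
  obtain ⟨i, hi⟩ := hai
  -- The tuple `c` will enumerate the coordinates of `e` in `J`.
  set J := basisIndices L (Set.range a) e
  have hJ : ¬ Set.range e ⊆ acl L (e '' J) :=
    hM'.not_range_subset_acl (mem_acl_basisIndices (Set.range e) a i) hi
  have heJ : ∀ j, e j ∈ acl L (e '' J ∪ Set.range a) := fun j => by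
    rw [Set.union_comm]
    exact mem_acl_basisIndices (Set.range a) e j
  choose D K hD heD hK using fun j => exists_bounded_fiber (heJ j)
  have hDe : ∀ j, (Set.range e).Definable L {x | e j ∈ fiber (D j) x} := by
    intro j
    refine ((hD j).mono (Set.image_subset_range _ _)).preimage_map
      (F := fun x : Fin n → M => Sum.elim x fun _ => e j) ?_
    rintro (i | i)
    · exact Set.DefinableFun.proj L
    · exact L.definableFun_const _ ⟨j, rfl⟩
  -- The factor `X₁` makes `e` a canonical parameter; the other factor gives weak normality.
  have hXP : X₁ ∩ {x | ∀ j, e j ∈ fiber (D j) x} ∈ TypeOver.sets p := by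
    refine hinter _ hX₁ _ ((hP _).2 ⟨?_, heD⟩)
    rw [Set.ofPred_forall]
    exact Set.definable_iInter_of_finite hDe
  have hXd := hPdef _ hXP
  refine ⟨_, hXP, ⟨hXd.mono (Set.subset_univ _), fun σ => ⟨fun h => ?_, fun h => ?_⟩⟩,
    Nat.card J, fun i => e ((Finite.equivFin J).symm i), ?_⟩
  · refine hfix _ hXP Set.inter_subset_left σ ?_
    rw [h, Set.inter_self]
    exact hlarge _ hXP
  · exact conj_eq_self hXd (by rintro _ ⟨j, rfl⟩; exact h j)
  · have hrange : Set.range (fun i => e ((Finite.equivFin J).symm i)) = e '' J := by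
      rw [Set.image_eq_range]
      exact (Finite.equivFin J).symm.surjective.range_comp (fun j : J => e j)
    rw [hrange]
    exact ⟨(Set.image_subset_range _ _).trans (subset_dcl _), hJ,
      weaklyNormalRel_of_bounded hXd ⟨a, ((hP _).1 hXP).2⟩ hD
        (fun j x => Set.finite_of_encard_le_coe (hK j x)) fun x hx => hx.2⟩
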